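/- **Proposition.** Let $M\subset\mathbb{C}^N$ be a smooth generic real submanifold of real codimension $d$: near each of its points, $M=\{\rho_1=\dots=\rho_d=0\}$ with $\rho=(\rho_1,\dots,\rho_d)$ smooth and real-valued and $\partial\rho_1,\dots,\partial\rho_d$ linearly independent over $\mathbb{C}$. Let $p\in M$. Suppose that, after a local biholomorphic change of coordinates sending $p$ to $0$, the submanifold $M$ is given near $p$, in coordinates $(z,w)\in\mathbb{C}^n\times\mathbb{C}^d$, by the reduced equations $$\mathrm{Im}\,w_k={}^t\bar z A_k z+h_k(z,\mathrm{Re}\,w),\qquad k=1,\dots,d,$$ where $A_1,\dots,A_d$ are Hermitian $n\times n$ matrices and $h=(h_1,\dots,h_d)$ is smooth near $0$ with $h(z,u)=o(|z|^2+|u|)$ as $(z,u)\to 0$. Suppose that condition $(\mathfrak b)$ holds: $$\bigcap_{k=1}^d\mathrm{Ker}\,A_k=\{0\}.$$ Then $M$ is holomorphically nondegenerate (in the formal sense) at $p$, that is, there is no nontrivial formal holomorphic vector field at $p$ tangent to $M$. Here a formal holomorphic vector field at $p$ is $X=\sum_{j=1}^N a_j(Z)\,\partial/\partial Z_j$ with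 $a_j\in\mathbb{C}[[Z-p]]$; it is nontrivial if some $a_j\neq 0$. It is tangent to $M$ at $p$ if, for a local defining function $\rho$ of $M$ near $p$ as above, identified with its Taylor series at $p$ in $\mathbb{C}[[Z-p,\bar Z-\bar p]]$, there are $c_{kl}\in\mathbb{C}[[Z-p,\bar Z-\bar p]]$ with $X\rho_k=\sum_{l=1}^d c_{kl}\rho_l$ for all $k$ (this does not depend on the choice of $\rho$). -/

import Mathlib

open scoped Topology ContDiff

namespace CRGeometry

/-- The Wirtinger derivative `∂f/∂Z_j = (1/2) (∂f/∂x_j - i ∂f/∂y_j)`, where `Z_j = x_j + i y_j`. -/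
noncomputable def dZ {N : ℕ} (j : Fin N) (f : (Fin N → ℂ) → ℂ) : (Fin N → ℂ) → ℂ := fun Z =>
  (1 / 2 : ℂ) * (fderiv ℝ f Z (Pi.single j 1) - Complex.I * fderiv ℝ f Z (Pi.single j Complex.I))

/-- The conjugate Wirtinger derivative `∂f/∂Z̄_j = (1/2) (∂f/∂x_j + i ∂f/∂y_j)`. -/
noncomputable def dZbar {N : ℕ} (j : Fin N) (f : (Fin N → ℂ) → ℂ) : (Fin N → ℂ) → ℂ := fun Z =>
  (1 / 2 : ℂ) * (fderiv ℝ f Z (Pi.single j 1) + Complex.I * fderiv ℝ f Z (Pi.single j Complex.I))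

/-- The iterated derivative `D_0^{α_0} ⋯ D_{N-1}^{α_{N-1}} f`. -/
def iterD {N : ℕ} (D : Fin N → ((Fin N → ℂ) → ℂ) → ((Fin N → ℂ) → ℂ)) (α : Fin N → ℕ)
    (f : (Fin N → ℂ) → ℂ) : (Fin N → ℂ) → ℂ :=
  (List.finRange N).foldr (fun j g => (D j)^[α j] g) f

/-- The formal Taylor series at `p` of a function on `ℂ^N` that is smooth near `p`, as a power
series in the `2N` variables `Z - p` (indices `Sum.inl j`) and `Z̄ - p̄` (indices `Sum.inr j`):
the coefficient of `(Z - p)^α (Z̄ - p̄)^β` is `(∂_Z^α ∂_Z̄^β f)(p) / (α! β!)`. -/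
noncomputable def taylorSeries {N : ℕ} (f : (Fin N → ℂ) → ℂ) (p : Fin N → ℂ) :
    MvPowerSeries (Fin N ⊕ Fin N) ℂ := fun m =>
  iterD dZ (fun j => m (Sum.inl j)) (iterD dZbar (fun j => m (Sum.inr j)) f) p /
    ((∏ s, (m s).factorial : ℕ) : ℂ)

/-- `ρ = (ρ_1, …, ρ_d)` is a smooth local defining function of `M ⊆ ℂ^N` on the open
neighbourhood `U` of `p`, with `∂ρ_1, …, ∂ρ_d` linearly independent over `ℂ`. -/
structure IsGenericDefiningFunction {N d : ℕ} (M : Set (Fin N → ℂ)) (p : Fin N → ℂ)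
    (U : Set (Fin N → ℂ)) (ρ : (Fin N → ℂ) → Fin d → ℝ) : Prop where
  isOpen : IsOpen U
  mem : p ∈ U
  contDiffOn : ContDiffOn ℝ ∞ ρ U
  zeroSet : ∀ Z ∈ U, Z ∈ M ↔ ρ Z = 0
  generic : ∀ Z ∈ U, LinearIndependent ℂ
    (fun k : Fin d => fun j : Fin N => dZ j (fun W => (ρ W k : ℂ)) Z)

/-- `M` is a smooth generic real submanifold of `ℂ^N` of real codimension `d`. -/
def IsSmoothGenericSubmanifold {N : ℕ} (M : Set (Fin N → ℂ)) (d : ℕ) : Prop :=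
  ∀ p ∈ M, ∃ (U : Set (Fin N → ℂ)) (ρ : (Fin N → ℂ) → Fin d → ℝ),
    IsGenericDefiningFunction M p U ρ

/-- A formal holomorphic vector field `∑_j a_j(Z) ∂/∂Z_j` at a point `p`, given by its
coefficients `a_j ∈ ℂ[[Z - p]]`. -/
abbrev FormalHolVectorField (N : ℕ) : Type := Fin N → MvPowerSeries (Fin N) ℂ

/-- The action of `X = ∑_j a_j(Z) ∂/∂Z_j` on a formal series in `(Z - p, Z̄ - p̄)`. -/
noncomputable def FormalHolVectorField.act {N : ℕ} (X : FormalHolVectorField N)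
    (F : MvPowerSeries (Fin N ⊕ Fin N) ℂ) : MvPowerSeries (Fin N ⊕ Fin N) ℂ :=
  ∑ j, MvPowerSeries.rename Sum.inl (X j) * MvPowerSeries.pderiv ℂ (Sum.inl j) F

/-- `X` is tangent at `p` to the generic submanifold `M` of codimension `d`: for a local defining
function `ρ` near `p`, with Taylor series again written `ρ`, there are formal power series `c_{kl}`
in `(Z - p, Z̄ - p̄)` with `X ρ_k = ∑_l c_{kl} ρ_l` for all `k`.
(This does not depend on the choice of `ρ`.) -/
def FormalHolVectorField.IsTangentAt {N : ℕ} (X : FormalHolVectorField N)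
    (M : Set (Fin N → ℂ)) (d : ℕ) (p : Fin N → ℂ) : Prop :=
  ∃ (U : Set (Fin N → ℂ)) (ρ : (Fin N → ℂ) → Fin d → ℝ),
    IsGenericDefiningFunction M p U ρ ∧
    ∃ c : Fin d → Fin d → MvPowerSeries (Fin N ⊕ Fin N) ℂ, ∀ k,
      X.act (taylorSeries (fun Z => (ρ Z k : ℂ)) p) =
        ∑ l, c k l * taylorSeries (fun Z => (ρ Z l : ℂ)) p

/-- `M` is holomorphically nondegenerate (in the formal sense) at `p`: there is no nontrivial
formal holomorphic vector field at `p` tangent to `M`. -/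
def IsFormallyHolNondegenerateAt {N : ℕ} (M : Set (Fin N → ℂ)) (d : ℕ) (p : Fin N → ℂ) : Prop :=
  ¬ ∃ X : FormalHolVectorField N, X ≠ 0 ∧ X.IsTangentAt M d p

/-- After the local biholomorphic change of coordinates `Φ`, with `Φ p = 0`, the set `M` is given
near `p` in the coordinates `(z, w) ∈ ℂ^n × ℂ^d` by the reduced equations
`Im w_k = ᵗz̄ A_k z + h_k(z, Re w)`, with `A_k` Hermitian and `h` smooth and negligible: `h` is
`o(|z|² + |u|)` at `0`, where `u = Re w`. -/
structure IsReducedFormAt {N n d : ℕ} (M : Set (Fin N → ℂ)) (p : Fin N → ℂ)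
    (A : Fin d → Matrix (Fin n) (Fin n) ℂ)
    (Φ : OpenPartialHomeomorph (Fin N → ℂ) ((Fin n → ℂ) × (Fin d → ℂ)))
    (h : (Fin n → ℂ) × (Fin d → ℝ) → Fin d → ℝ) : Prop where
  hermitian : ∀ k, (A k).IsHermitian
  mem_source : p ∈ Φ.source
  map_base : Φ p = 0
  holomorphic : DifferentiableOn ℂ Φ Φ.source
  holomorphic_symm : DifferentiableOn ℂ Φ.symm Φ.target
  smooth : ∃ V ∈ 𝓝 (0 : (Fin n → ℂ) × (Fin d → ℝ)), ContDiffOn ℝ ∞ h V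
  negligible : h =o[𝓝 0] (fun x : (Fin n → ℂ) × (Fin d → ℝ) => ‖x.1‖ ^ 2 + ‖x.2‖)
  equation : ∀ᶠ Z in 𝓝 p, Z ∈ M ↔ ∀ k, (((Φ Z).2 k).im : ℂ) =
    star (Φ Z).1 ⬝ᵥ (A k).mulVec (Φ Z).1 + (h ((Φ Z).1, fun l => ((Φ Z).2 l).re) k : ℂ)

/-- Condition (b): the matrices `A_1, …, A_d` have no common nonzero kernel vector. -/
def ConditionB {n d : ℕ} (A : Fin d → Matrix (Fin n) (Fin n) ℂ) : Prop :=
  ⨅ k, LinearMap.ker (A k).mulVecLin = ⊥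

end CRGeometry

/-!
Since `h = o(|z|² + |u|)`, the Levi form at `0` of the reduced equations is, up to sign,
`(ᵗz̄ A_k z)_k` on the complex tangent space `{w = 0}`, and condition (b) says that it is
nondegenerate. This property is invariant under biholomorphic maps. It also depends only on the
zero set: if `g` is constant on the level set of `f` through `p`, then `dg = T ∘ df` at `p`, and
comparing second derivatives along curves in the level set shows that the Levi form of `g` on the
complex tangent space is the image under `T` of that of `f`. So every defining function `ρ` of `M`
is Levi nondegenerate at `p`.

Now let `∑ a_j ∂/∂Z_j` be a formal holomorphic field tangent to `M`, that is,
`∑ a_j ∂ρ_k/∂Z_j ∈ I` for the ideal `I` generated by the `ρ_k`. A derivation `D` in the variables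
`Z̄` with `D ρ = 0` preserves `I` and kills every `a_j`, so also `∑ a_j D(∂ρ_k/∂Z_j) ∈ I`. By Levi
nondegeneracy the values at `p` of the rows `(∂ρ_k/∂Z_j)_j` and `(D(∂ρ_k/∂Z_j))_j` span, hence by
inverting a matrix over the local ring of formal power series each `a_j` lies in `I`. But `I`
contains no nonzero series `a` in `Z` alone: each `∂/∂Z_i` can be corrected by derivations in `Z̄`
so as to kill `ρ`, hence all partial derivatives of `a` remain in `I`, and they vanish at `p`.
-/

namespace CRGeometry

open Matrix
section ResidueField

theorem mulVec_surjective_of_linearIndependent_row {K m n : Type*} [Field K] [Finite m]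
    [Fintype n] {P : Matrix m n K} (hP : LinearIndependent K P.row) :
    Function.Surjective P.mulVec := by
  cases nonempty_fintype m
  have hrange : LinearMap.range P.mulVecLin = ⊤ := Submodule.eq_top_of_finrank_eq <| by
    rw [Module.finrank_fintype_fun_eq_card]
    exact hP.rank_matrix
  exact LinearMap.range_eq_top.mp hrange

variable {R K m n : Type*} [CommRing R] [Field K] [Fintype n] (π : R →+* K)

theorem isUnit_det_of_map_eq_one [DecidableEq n] [IsLocalHom π] {B : Matrix n n R}
    (hB : B.map π = 1) : IsUnit B.det :=
  isUnit_of_map_unit π _ <| by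
    rw [RingHom.map_det, RingHom.mapMatrix_apply, hB, Matrix.det_one]
    exact isUnit_one

variable [RingHomSurjective π]

theorem exists_mul_eq_one_of_linearIndependent_map [IsLocalHom π] [Finite m]
    [DecidableEq m] {P : Matrix m n R} (hP : LinearIndependent K (P.map π).row) :
    ∃ S : Matrix n m R, P * S = 1 := by
  classical
  cases nonempty_fintype m
  obtain ⟨S₀, hS₀⟩ := Matrix.mulVec_surjective_iff_exists_right_inverse.mp
    (mulVec_surjective_of_linearIndependent_row hP)
  choose lift hlift using RingHomSurjective.is_surjective (σ := π)
  have hmap : (P * S₀.map lift).map π = 1 := by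
    rw [Matrix.map_mul, ← hS₀]
    congr 1
    ext i j
    exact hlift _
  exact ⟨S₀.map lift * (P * S₀.map lift)⁻¹, by
    rw [← Matrix.mul_assoc, Matrix.mul_nonsing_inv _ (isUnit_det_of_map_eq_one π hmap)]⟩

/-- The reductions along `π` of the linear relations modulo `I` between the entries of `a`. -/
def relationsModIdeal (I : Ideal R) (a : n → R) : Submodule K (n → K) where
  carrier := {x | ∃ b : n → R, b ⬝ᵥ a ∈ I ∧ π ∘ b = x}
  zero_mem' := ⟨0, by simp, by ext; simp⟩
  add_mem' := by
    rintro _ _ ⟨b, hb, rfl⟩ ⟨c, hc, rfl⟩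
    exact ⟨b + c, by simpa only [add_dotProduct] using add_mem hb hc, by ext; simp⟩
  smul_mem' := by
    rintro r _ ⟨b, hb, rfl⟩
    obtain ⟨s, rfl⟩ := RingHomSurjective.is_surjective (σ := π) r
    exact ⟨s • b, by simpa only [smul_dotProduct, smul_eq_mul] using I.mul_mem_left s hb,
      by ext; simp⟩

theorem mem_of_relationsModIdeal_eq_top [IsLocalHom π] {I : Ideal R} {a : n → R}
    (h : relationsModIdeal π I a = ⊤) (j : n) : a j ∈ I := by
  classical
  have hrow (i : n) : ∃ b : n → R, b ⬝ᵥ a ∈ I ∧ π ∘ b = Pi.single i 1 :=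
    show Pi.single i 1 ∈ relationsModIdeal π I a from h ▸ Submodule.mem_top
  choose B hBI hB using hrow
  have hdet : IsUnit (Matrix.of B).det := isUnit_det_of_map_eq_one π <| by
    ext i k
    simpa [Matrix.one_apply, Pi.single_apply, eq_comm] using congrFun (hB i) k
  have ha : (Matrix.of B)⁻¹ *ᵥ (Matrix.of B *ᵥ a) = a := by
    rw [Matrix.mulVec_mulVec, Matrix.nonsing_inv_mul _ hdet, Matrix.one_mulVec]
  rw [← ha]
  exact I.sum_mem fun k _ => I.mul_mem_left _ (hBI k)

theorem mem_of_forall_dotProduct_map_eq_zero [IsLocalHom π] {I : Ideal R} {a : n → R}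
    (h : ∀ v : n → K, (∀ b : n → R, b ⬝ᵥ a ∈ I → v ⬝ᵥ (π ∘ b) = 0) → v = 0) (j : n) :
    a j ∈ I := by
  classical
  refine mem_of_relationsModIdeal_eq_top π ?_ j
  by_contra hne
  obtain ⟨f, hf₀, hf⟩ := Submodule.exists_le_ker_of_lt_top _ (lt_top_iff_ne_top.mpr hne)
  obtain ⟨v, rfl⟩ := (dotProductEquiv K n).surjective f
  exact hf₀ (by rw [h v fun b hb => hf ⟨b, hb, rfl⟩, map_zero])

end ResidueField

section TangentialPart

variable {R A ι J : Type*} [CommRing R] [CommRing A] [Algebra R A]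

theorem derivation_sum_apply (s : Finset J) (D : J → Derivation R A A) (f : A) :
    (∑ j ∈ s, D j) f = ∑ j ∈ s, D j f :=
  map_sum ((Pi.evalAddMonoidHom (fun _ => A) f).comp Derivation.coeFnAddMonoidHom) D s

theorem derivation_mem_span {D : Derivation R A A} {ρ : ι → A} (hD : ∀ k, D (ρ k) = 0) {f : A}
    (hf : f ∈ Ideal.span (Set.range ρ)) : D f ∈ Ideal.span (Set.range ρ) := by
  induction hf using Submodule.span_induction with
  | mem x hx =>
    obtain ⟨k, rfl⟩ := hx
    simp [hD]
  | zero => simp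
  | add x y _ _ hx hy =>
    rw [map_add]
    exact add_mem hx hy
  | smul a x hx hx' =>
    rw [smul_eq_mul, Derivation.leibniz]
    exact add_mem (Ideal.mul_mem_left _ _ hx') (Ideal.mul_mem_right _ _ hx)

variable [Fintype ι] [Fintype J]

/-- The derivation `D` corrected by a combination of the derivations `δ j` so as to annihilate
every `ρ k`, when `S` is a right inverse of the matrix `(δ j (ρ k))`: a formal version of the
projection of a vector field to the tangent space of `ρ = 0`. -/
def tangentialPart (δ : J → Derivation R A A) (ρ : ι → A) (S : Matrix J ι A)
    (D : Derivation R A A) : Derivation R A A :=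
  D - ∑ j, (S *ᵥ fun k => D (ρ k)) j • δ j

theorem tangentialPart_apply (δ : J → Derivation R A A) (ρ : ι → A) (S : Matrix J ι A)
    (D : Derivation R A A) (f : A) :
    tangentialPart δ ρ S D f = D f - (S *ᵥ fun k => D (ρ k)) ⬝ᵥ fun j => δ j f := by
  simp only [tangentialPart, Derivation.sub_apply, derivation_sum_apply, Derivation.smul_apply,
    smul_eq_mul, dotProduct]

theorem tangentialPart_apply_of_forall_eq_zero (δ : J → Derivation R A A) (ρ : ι → A)
    (S : Matrix J ι A) (D : Derivation R A A) {f : A} (hf : ∀ j, δ j f = 0) :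
    tangentialPart δ ρ S D f = D f := by
  simp [tangentialPart_apply, hf, dotProduct]

theorem tangentialPart_apply_self [DecidableEq ι] {δ : J → Derivation R A A} {ρ : ι → A}
    {S : Matrix J ι A} (hS : (Matrix.of fun k j => δ j (ρ k)) * S = 1) (D : Derivation R A A)
    (k : ι) : tangentialPart δ ρ S D (ρ k) = 0 := by
  have h : (Matrix.of fun k j => δ j (ρ k)) *ᵥ (S *ᵥ fun k => D (ρ k)) = fun k => D (ρ k) := by
    rw [Matrix.mulVec_mulVec, hS, Matrix.one_mulVec]
  rw [tangentialPart_apply, dotProduct_comm, sub_eq_zero]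
  exact (congrFun h k).symm

end TangentialPart

section PartialDerivatives

open MvPowerSeries Finsupp

variable {R σ τ : Type*} [CommSemiring R]

theorem pderiv_rename_of_injective {f : σ → τ} [Filter.TendstoCofinite f]
    (hf : Function.Injective f) (i : σ) (a : MvPowerSeries σ R) :
    pderiv R (f i) (rename f a) = rename f (pderiv R i a) := by
  have hcoeff (b : MvPowerSeries σ R) (x : σ →₀ ℕ) :
      coeff (mapDomain f x) (rename f b) = coeff x b := by
    rw [← coeff_embDomain_rename ⟨f, hf⟩ b x, embDomain_eq_mapDomain]
    rfl
  ext m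
  rw [coeff_pderiv]
  by_cases hm : m ∈ Set.range (mapDomain f)
  · obtain ⟨x, rfl⟩ := hm
    rw [← mapDomain_single, ← mapDomain_add, hcoeff, hcoeff, mapDomain_apply hf, coeff_pderiv]
  · rw [coeff_rename_eq_zero _ _ hm, coeff_rename_eq_zero, zero_mul]
    rintro ⟨x, hx⟩
    have hxi : single i 1 ≤ x := by
      have h := DFunLike.congr_fun hx (f i)
      rw [mapDomain_apply hf] at h
      exact single_le_iff.mpr (h ▸ by simp)
    refine hm ⟨x - single i 1, add_right_cancel (b := single (f i) 1) ?_⟩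
    rw [← hx, ← mapDomain_single, ← mapDomain_add, tsub_add_cancel_of_le hxi]

theorem pderiv_rename_of_notMem_range (f : σ → τ) [Filter.TendstoCofinite f] {j : τ}
    (hj : j ∉ Set.range f) (a : MvPowerSeries σ R) : pderiv R j (rename f a) = 0 := by
  ext m
  rw [coeff_pderiv, coeff_rename_eq_zero, zero_mul, map_zero]
  rintro ⟨x, hx⟩
  have h := DFunLike.congr_fun hx j
  rw [mapDomain_of_notMem_range _ _ hj] at h
  simp at h

theorem constantCoeff_pderiv (i : σ) (f : MvPowerSeries σ R) :
    constantCoeff (pderiv R i f) = coeff (single i 1) f := by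
  rw [← coeff_zero_eq_constantCoeff_apply, coeff_pderiv]
  simp

theorem constantCoeff_pderiv_pderiv {i j : σ} (hij : i ≠ j) (f : MvPowerSeries σ R) :
    constantCoeff (pderiv R i (pderiv R j f)) = coeff (single j 1 + single i 1) f := by
  rw [constantCoeff_pderiv, coeff_pderiv, add_comm]
  simp [hij]

theorem eq_zero_of_forall_pderiv [NoZeroDivisors R] [CharZero R] {S : Set (MvPowerSeries σ R)}
    (h₀ : ∀ a ∈ S, constantCoeff a = 0) (hS : ∀ a ∈ S, ∀ i, pderiv R i a ∈ S)
    {a : MvPowerSeries σ R} (ha : a ∈ S) : a = 0 := by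
  suffices h : ∀ n, ∀ m : σ →₀ ℕ, m.degree = n → ∀ a ∈ S, coeff m a = 0 from
    MvPowerSeries.ext fun m => h _ m rfl a ha
  intro n
  induction n with
  | zero =>
    intro m hm a ha
    rw [(degree_eq_zero_iff m).mp hm]
    exact h₀ a ha
  | succ n ih =>
    intro m hm a ha
    obtain ⟨i, hi⟩ : ∃ i, m i ≠ 0 := by
      by_contra! h
      simp [Finsupp.ext (g := 0) h] at hm
    have hsplit : m - single i 1 + single i 1 = m := tsub_add_cancel_of_le <| by
      simpa [single_le_iff, Nat.one_le_iff_ne_zero] using hi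
    have hdeg : (m - single i 1).degree = n := by
      rw [← hsplit, map_add, degree_single] at hm
      exact Nat.succ_injective hm
    have hcoeff := ih _ hdeg _ (hS a ha i)
    rw [coeff_pderiv, hsplit] at hcoeff
    exact (mul_eq_zero.mp hcoeff).resolve_right (Nat.cast_add_one_ne_zero _)

end PartialDerivatives

section FormalSubmanifold

open MvPowerSeries Finsupp

variable {K σ τ ι : Type*} [Field K]

/-- The coefficients of the linear part of `f` in the first group of variables, that is, the value
at the base point of `∂f/∂Z`. -/
noncomputable def holGrad (f : MvPowerSeries (σ ⊕ τ) K) : σ → K :=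
  fun j => coeff (single (Sum.inl j) 1) f

/-- The coefficients of the linear part of `f` in the second group of variables, that is, the value
at the base point of `∂f/∂Z̄`. -/
noncomputable def antiholGrad (f : MvPowerSeries (σ ⊕ τ) K) : τ → K :=
  fun l => coeff (single (Sum.inr l) 1) f

/-- The coefficients of the mixed quadratic part of `f`, that is, the value at the base point of
`∂²f/∂Z∂Z̄`. -/
noncomputable def leviMatrix (f : MvPowerSeries (σ ⊕ τ) K) : Matrix σ τ K :=
  Matrix.of fun j l => coeff (single (Sum.inl j) 1 + single (Sum.inr l) 1) f

/-- The formal generic submanifold `ρ = 0` is Levi nondegenerate at the base point: no nonzero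
vector in the kernel of `∂ρ` is orthogonal, for the Levi forms of all the `ρ k`, to the kernel of
`∂̄ρ`. -/
def IsFormallyLeviNondegenerate [Fintype σ] [Fintype τ] (ρ : ι → MvPowerSeries (σ ⊕ τ) K) :
    Prop :=
  ∀ v : σ → K, (∀ k, v ⬝ᵥ holGrad (ρ k) = 0) →
    (∀ w : τ → K, (∀ k, w ⬝ᵥ antiholGrad (ρ k) = 0) → ∀ k, v ⬝ᵥ leviMatrix (ρ k) *ᵥ w = 0) →
    v = 0

instance isLocalHom_constantCoeff : IsLocalHom (constantCoeff (σ := σ) (R := K)) where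
  map_nonunit _ h := isUnit_iff_constantCoeff.mpr h

instance ringHomSurjective_constantCoeff :
    RingHomSurjective (constantCoeff (σ := σ) (R := K)) where
  is_surjective r := ⟨C r, constantCoeff_C r⟩

theorem constantCoeff_eq_zero_of_mem_span {ρ : ι → MvPowerSeries σ K}
    (h₀ : ∀ k, constantCoeff (ρ k) = 0) {f : MvPowerSeries σ K}
    (hf : f ∈ Ideal.span (Set.range ρ)) : constantCoeff f = 0 := by
  have hle : Ideal.span (Set.range ρ) ≤ RingHom.ker (constantCoeff (σ := σ) (R := K)) :=
    Ideal.span_le.mpr (Set.range_subset_iff.mpr h₀)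
  exact hle hf

variable [Fintype τ] {ρ : ι → MvPowerSeries (σ ⊕ τ) K}
  {S : Matrix τ ι (MvPowerSeries (σ ⊕ τ) K)}

theorem exists_right_inverse_of_linearIndependent_antiholGrad [Finite ι] [DecidableEq ι]
    (hgen : LinearIndependent K fun k => antiholGrad (ρ k)) :
    ∃ S : Matrix τ ι (MvPowerSeries (σ ⊕ τ) K),
      (Matrix.of fun k l => pderiv K (Sum.inr l) (ρ k)) * S = 1 := by
  refine exists_mul_eq_one_of_linearIndependent_map constantCoeff ?_
  convert hgen using 1
  ext k l
  exact constantCoeff_pderiv _ _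

theorem constantCoeff_tangentialPart_pderiv_inl [Fintype ι] {w : τ → K}
    (hw : ∀ k, w ⬝ᵥ antiholGrad (ρ k) = 0) (f : MvPowerSeries (σ ⊕ τ) K) (j : σ) :
    constantCoeff (tangentialPart (fun l => pderiv K (Sum.inr l)) ρ S
      (∑ l, w l • pderiv K (Sum.inr l)) (pderiv K (Sum.inl j) f)) = (leviMatrix f *ᵥ w) j := by
  have hconst (g : MvPowerSeries (σ ⊕ τ) K) :
      constantCoeff ((∑ l, w l • pderiv K (Sum.inr l)) g) =
        ∑ l, w l * constantCoeff (pderiv K (Sum.inr l) g) := by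
    simp only [derivation_sum_apply, Derivation.smul_apply, map_sum, constantCoeff_smul,
      smul_eq_mul]
  have hρ (k : ι) : constantCoeff ((∑ l, w l • pderiv K (Sum.inr l)) (ρ k)) = 0 := by
    simp only [hconst, constantCoeff_pderiv]
    exact hw k
  rw [tangentialPart_apply]
  simp only [map_sub, mulVec, dotProduct, map_sum, map_mul, hρ, mul_zero, Finset.sum_const_zero,
    zero_mul, sub_zero, hconst]
  refine Finset.sum_congr rfl fun l _ => ?_
  rw [constantCoeff_pderiv_pderiv Sum.inr_ne_inl, mul_comm]
  rfl

variable [CharZero K]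

theorem eq_zero_of_rename_mem_span [Finite σ] [Finite ι] [DecidableEq ι]
    (h₀ : ∀ k, constantCoeff (ρ k) = 0)
    (hS : (Matrix.of fun k l => pderiv K (Sum.inr l) (ρ k)) * S = 1) {a : MvPowerSeries σ K}
    (ha : rename Sum.inl a ∈ Ideal.span (Set.range ρ)) : a = 0 := by
  cases nonempty_fintype ι
  refine eq_zero_of_forall_pderiv (S := {a | rename Sum.inl a ∈ Ideal.span (Set.range ρ)})
    (fun a ha => ?_) (fun a ha i => ?_) ha
  · rw [← constantCoeff_rename Sum.inl a]
    exact constantCoeff_eq_zero_of_mem_span h₀ ha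
  · have hmem := derivation_mem_span
      (tangentialPart_apply_self hS (pderiv K (Sum.inl i : σ ⊕ τ))) ha
    rwa [tangentialPart_apply_of_forall_eq_zero _ _ _ _
      fun l => pderiv_rename_of_notMem_range _ (by simp) _,
      pderiv_rename_of_injective Sum.inl_injective] at hmem

/-- On a Levi nondegenerate formal generic submanifold, differentiating the tangency equations of
a formal holomorphic field along antiholomorphic tangent fields, which kill its coefficients,
produces enough further equations to put all its coefficients in the ideal of `ρ`. -/
theorem eq_zero_of_isFormallyLeviNondegenerate [Fintype σ] [Finite ι]
    (h₀ : ∀ k, constantCoeff (ρ k) = 0)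
    (hgen : LinearIndependent K fun k => antiholGrad (ρ k)) (hρ : IsFormallyLeviNondegenerate ρ)
    {X : σ → MvPowerSeries σ K}
    (hX : ∀ k, ∑ j, rename Sum.inl (X j) * pderiv K (Sum.inl j) (ρ k) ∈
      Ideal.span (Set.range ρ)) : X = 0 := by
  classical
  cases nonempty_fintype ι
  obtain ⟨S, hS⟩ := exists_right_inverse_of_linearIndependent_antiholGrad hgen
  have hrow (k : ι) : (fun j => pderiv K (Sum.inl j) (ρ k)) ⬝ᵥ (fun j => rename Sum.inl (X j)) ∈
      Ideal.span (Set.range ρ) := by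
    rw [dotProduct_comm]
    exact hX k
  refine funext fun j => eq_zero_of_rename_mem_span h₀ hS ?_
  refine mem_of_forall_dotProduct_map_eq_zero constantCoeff
    (a := fun j => rename Sum.inl (X j)) (fun v hv => hρ v (fun k => ?_) fun w hw k => ?_) j
  · convert hv _ (hrow k)
    ext j
    exact (constantCoeff_pderiv _ _).symm
  · set D := tangentialPart (fun l => pderiv K (Sum.inr l)) ρ S (∑ l, w l • pderiv K (Sum.inr l))
    have hDX (j : σ) : D (rename Sum.inl (X j)) = 0 := by
      have h (l : τ) : pderiv K (Sum.inr l : σ ⊕ τ) (rename Sum.inl (X j)) = 0 :=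
        pderiv_rename_of_notMem_range _ (by simp) _
      rw [tangentialPart_apply_of_forall_eq_zero _ _ _ _ h, derivation_sum_apply]
      simp [h]
    have hDrow := derivation_mem_span (tangentialPart_apply_self hS _) (hrow k) (D := D)
    have hDrow' : (fun j => D (pderiv K (Sum.inl j) (ρ k))) ⬝ᵥ (fun j => rename Sum.inl (X j)) ∈
        Ideal.span (Set.range ρ) := by
      simpa only [dotProduct, map_sum, Derivation.leibniz, hDX, smul_eq_mul, mul_zero, zero_add,
        mul_comm (rename _ _)] using hDrow
    simpa only [Function.comp_def, D, constantCoeff_tangentialPart_pderiv_inl hw] using hv _ hDrow'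

end FormalSubmanifold

section HolomorphicFunctions

open Metric

variable {E F : Type*} [NormedAddCommGroup E] [NormedSpace ℂ E] [NormedAddCommGroup F]
  [NormedSpace ℂ F]

theorem exists_ball_add_self_subset {X : Type*} [PseudoMetricSpace X] {U : Set X}
    (hU : IsOpen U) {x : X} (hx : x ∈ U) : ∃ r > 0, ball x (r + r) ⊆ U := by
  obtain ⟨r, hr, hrU⟩ := isOpen_iff.mp hU x hx
  exact ⟨r / 2, half_pos hr, by rwa [add_halves]⟩

theorem ball_subset_ball_add_self {X : Type*} [PseudoMetricSpace X] {x y : X} {r : ℝ}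
    (hy : y ∈ ball x r) : ball y r ⊆ ball x (r + r) :=
  ball_subset_ball' (by linarith [mem_ball.mp hy])

theorem norm_fderiv_le_of_forall_mem_ball {f : E → F} {c : E} {R B : ℝ} (hR : 0 < R)
    (hf : DifferentiableOn ℂ f (ball c R)) (hB : ∀ x ∈ ball c R, ‖f x‖ ≤ B) :
    ‖fderiv ℂ f c‖ ≤ 2 * B / R := by
  refine Complex.norm_fderiv_le_div_of_mapsTo_ball hf (fun x hx => ?_) hR
  rw [mem_closedBall, dist_eq_norm]
  linarith [norm_sub_le (f x) (f c), hB x hx, hB c (mem_ball_self hR)]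

theorem uniformCauchySeqOn_fderiv {κ : Type*} {l : Filter κ} {f : κ → E → F} {s t : Set E}
    {r : ℝ} (hr : 0 < r) (ht : IsOpen t) (hst : ∀ x ∈ s, ball x r ⊆ t)
    (hdiff : ∀ᶠ n in l, DifferentiableOn ℂ (f n) t) (hf : UniformCauchySeqOn f l t) :
    UniformCauchySeqOn (fun n => fderiv ℂ (f n)) l s := by
  intro u hu
  obtain ⟨ε, hε, hεu⟩ := mem_uniformity_dist.mp hu
  filter_upwards [hf _ (dist_mem_uniformity (by positivity : 0 < ε * r / 4)),
    hdiff.prod_mk hdiff] with n hn hd x hx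
  have hxt : t ∈ 𝓝 x := ht.mem_nhds (hst x hx (mem_ball_self hr))
  have hle : ‖fderiv ℂ (f n.1 - f n.2) x‖ ≤ 2 * (ε * r / 4) / r :=
    norm_fderiv_le_of_forall_mem_ball hr ((hd.1.sub hd.2).mono (hst x hx)) fun y hy => by
      rw [Pi.sub_apply, ← dist_eq_norm]
      exact (hn y (hst x hx hy)).le
  rw [fderiv_sub (hd.1.differentiableAt hxt) (hd.2.differentiableAt hxt), ← dist_eq_norm] at hle
  refine hεu (hle.trans_lt ?_)
  field_simp
  linarith

theorem differentiableOn_of_tendstoUniformlyOn [CompleteSpace F] {κ : Type*} {l : Filter κ}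
    [l.NeBot] {f : κ → E → F} {g : E → F} {U : Set E} (hU : IsOpen U)
    (hdiff : ∀ᶠ n in l, DifferentiableOn ℂ (f n) U) (hf : TendstoUniformlyOn f g l U) :
    DifferentiableOn ℂ g U := by
  intro x hx
  obtain ⟨r, hr, hrU⟩ := exists_ball_add_self_subset hU hx
  have hcauchy : UniformCauchySeqOn (fun n => fderiv ℂ (f n)) l (ball x r) :=
    uniformCauchySeqOn_fderiv hr hU (fun y hy => (ball_subset_ball_add_self hy).trans hrU) hdiff
      hf.uniformCauchySeqOn
  have hlim (y : E) (hy : y ∈ ball x r) :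
      ∃ L, Filter.Tendsto (fun n => fderiv ℂ (f n) y) l (𝓝 L) :=
    CompleteSpace.complete (hcauchy.cauchy_map hy)
  choose! g' hg' using hlim
  have hball : ball x r ∈ 𝓝 x := ball_mem_nhds x hr
  have hxU : ∀ y ∈ ball x r, y ∈ U := fun y hy =>
    hrU (ball_subset_ball_add_self hy (mem_ball_self hr))
  refine (hasFDerivAt_of_tendstoUniformlyOnFilter (f := f) (g' := g')
    (((hcauchy.tendstoUniformlyOn_of_tendsto hg').tendstoUniformlyOnFilter).mono_right
      (Filter.le_principal_iff.mpr hball)) ?_ ?_).differentiableAt.differentiableWithinAt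
  · filter_upwards [hdiff.prod_mk hball] with n hn
    exact (hn.1.differentiableAt (hU.mem_nhds (hxU _ hn.2))).hasFDerivAt
  · filter_upwards [hball] with y hy using hf.tendsto_at (hxU y hy)

theorem norm_sub_sub_fderiv_le {f : E → F} {c z : E} {R B : ℝ}
    (hf : DifferentiableOn ℂ f (ball c R)) (hB : ∀ x ∈ ball c R, ‖f x‖ ≤ B)
    (hz : z ∈ ball c R) :
    ‖f z - f c - fderiv ℂ f c (z - c)‖ ≤ 4 * B * (‖z - c‖ / R) ^ 2 := by
  have hR : 0 < R := pos_of_mem_ball hz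
  have hc : c ∈ ball c R := mem_ball_self hR
  set g : E → F := fun x => f x - fderiv ℂ f c (x - c)
  have hgc (x : E) : g x - g c = f x - f c - fderiv ℂ f c (x - c) := by
    simp only [g, sub_self, map_zero, sub_zero]
    abel
  have hmaps : Set.MapsTo g (ball c R) (closedBall (g c) (4 * B)) := fun x hx => by
    have hderiv : ‖fderiv ℂ f c (x - c)‖ ≤ 2 * B := by
      calc ‖fderiv ℂ f c (x - c)‖ ≤ 2 * B / R * R :=
            ContinuousLinearMap.le_of_opNorm_le_of_le _
              (norm_fderiv_le_of_forall_mem_ball hR hf hB) (mem_ball_iff_norm.mp hx).le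
        _ = 2 * B := div_mul_cancel₀ _ hR.ne'
    rw [mem_closedBall, dist_eq_norm, hgc]
    linarith [norm_sub_le (f x - f c) (fderiv ℂ f c (x - c)), norm_sub_le (f x) (f c), hB x hx,
      hB c hc]
  have hlittleO : (fun x => g x - g c) =o[𝓝 c] fun x => ‖x - c‖ ^ 1 := by
    simpa only [hgc, pow_one] using
      (hf.differentiableAt (ball_mem_nhds c hR)).hasFDerivAt.isLittleO.norm_right
  have hdiff : DifferentiableOn ℂ g (ball c R) :=
    hf.sub ((fderiv ℂ f c).differentiable.comp (differentiable_id.sub_const c)).differentiableOn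
  simpa only [dist_eq_norm, hgc] using
    Complex.dist_le_mul_div_pow_of_mapsTo_ball_of_isLittleO hdiff hmaps hlittleO hz

theorem norm_inv_smul_sub_sub_fderiv_apply_le {f : E → F} {c v : E} {R B : ℝ}
    (hf : DifferentiableOn ℂ f (ball c R)) (hB : ∀ x ∈ ball c R, ‖f x‖ ≤ B) {t : ℂ} (ht : t ≠ 0)
    (htv : c + t • v ∈ ball c R) :
    ‖t⁻¹ • (f (c + t • v) - f c) - fderiv ℂ f c v‖ ≤ ‖t‖ * (4 * B * (‖v‖ / R) ^ 2) := by
  have hrem := norm_sub_sub_fderiv_le hf hB htv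
  rw [add_sub_cancel_left, map_smul, norm_smul] at hrem
  have : 0 < ‖t‖ := norm_pos_iff.mpr ht
  calc ‖t⁻¹ • (f (c + t • v) - f c) - fderiv ℂ f c v‖
      = ‖t‖⁻¹ * ‖f (c + t • v) - f c - t • fderiv ℂ f c v‖ := by
        rw [← norm_inv, ← norm_smul, smul_sub t⁻¹ (_ - _), inv_smul_smul₀ ht]
    _ ≤ ‖t‖⁻¹ * (4 * B * (‖t‖ * ‖v‖ / R) ^ 2) := by gcongr
    _ = ‖t‖ * (4 * B * (‖v‖ / R) ^ 2) := by field_simp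

theorem exists_forall_mem_ball_norm_le {f : E → F} {U : Set E} (hU : IsOpen U)
    (hf : DifferentiableOn ℂ f U) {c : E} (hc : c ∈ U) :
    ∃ r > 0, ∃ B, DifferentiableOn ℂ f (ball c (r + r)) ∧ ∀ x ∈ ball c (r + r), ‖f x‖ ≤ B := by
  have hbdd : ∀ᶠ x in 𝓝 c, ‖f x‖ ≤ ‖f c‖ + 1 :=
    (hf.differentiableAt (hU.mem_nhds hc)).continuousAt.norm.eventually_le_const (by linarith)
  obtain ⟨r, hr, hball⟩ := exists_ball_add_self_subset isOpen_interior
    (mem_interior_iff_mem_nhds.mpr (Filter.inter_mem (hU.mem_nhds hc) hbdd))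
  have hsub : ball c (r + r) ⊆ {x | x ∈ U ∧ ‖f x‖ ≤ ‖f c‖ + 1} := hball.trans interior_subset
  exact ⟨r, hr, _, hf.mono fun x hx => (hsub hx).1, fun x hx => (hsub hx).2⟩

/-- The directional derivatives are locally uniform limits of difference quotients, by the
quadratic estimate of the remainder. -/
theorem differentiableOn_fderiv_apply [CompleteSpace F] {f : E → F} {U : Set E} (hU : IsOpen U)
    (hf : DifferentiableOn ℂ f U) (v : E) : DifferentiableOn ℂ (fun x => fderiv ℂ f x v) U := by
  intro c hc
  obtain ⟨r, hr, B, hfr, hB⟩ := exists_forall_mem_ball_norm_le hU hf hc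
  have hsmall : ∀ᶠ t : ℂ in 𝓝[≠] 0, t • v ∈ ball (0 : E) r :=
    nhdsWithin_le_nhds <| (continuous_id.smul continuous_const).tendsto' (0 : ℂ) 0
      (zero_smul ℂ v) |>.eventually (ball_mem_nhds 0 hr)
  have hadd {x w : E} (hw : w ∈ ball (0 : E) r) : x + w ∈ ball x r := by
    simpa [mem_ball_iff_norm] using hw
  refine (differentiableOn_of_tendstoUniformlyOn (l := 𝓝[≠] (0 : ℂ))
    (f := fun t x => t⁻¹ • (f (x + t • v) - f x)) isOpen_ball ?_ ?_).differentiableAt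
    (ball_mem_nhds c hr) |>.differentiableWithinAt
  · filter_upwards [hsmall] with t ht
    refine ((hfr.comp (by fun_prop) fun x hx => ?_).sub (hfr.mono ?_)).const_smul t⁻¹
    · exact ball_subset_ball_add_self hx (hadd ht)
    · exact ball_subset_ball (by linarith)
  · refine Metric.tendstoUniformlyOn_iff.mpr fun ε hε => ?_
    have hlim : Filter.Tendsto (fun t : ℂ => ‖t‖ * (4 * B * (‖v‖ / r) ^ 2)) (𝓝[≠] 0) (𝓝 0) :=
      (Continuous.tendsto' (by fun_prop) _ _ (by simp)).mono_left nhdsWithin_le_nhds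
    filter_upwards [hsmall, hlim.eventually_lt_const hε, self_mem_nhdsWithin] with t ht htε ht0 x hx
    refine lt_of_le_of_lt ?_ htε
    have hball := ball_subset_ball_add_self hx
    rw [dist_comm, dist_eq_norm]
    exact norm_inv_smul_sub_sub_fderiv_apply_le (hfr.mono hball) (fun y hy => hB y (hball hy)) ht0
      (hadd ht)

theorem contDiffOn_of_differentiableOn_complex [FiniteDimensional ℂ E] [CompleteSpace F]
    {U : Set E} (hU : IsOpen U) (n : ℕ) {f : E → F} (hf : DifferentiableOn ℂ f U) :
    ContDiffOn ℂ n f U := by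
  induction n generalizing f with
  | zero => exact contDiffOn_zero.mpr hf.continuousOn
  | succ n ih =>
    rw [Nat.cast_add, Nat.cast_one, contDiffOn_succ_iff_fderiv_of_isOpen hU]
    exact ⟨hf, by simp, contDiffOn_clm_apply.mpr fun v =>
      ih (differentiableOn_fderiv_apply hU hf v)⟩

end HolomorphicFunctions

section CriticalPoints

open Asymptotics Filter

variable {E F G : Type*} [NormedAddCommGroup E] [NormedSpace ℝ E] [NormedAddCommGroup F]
  [NormedSpace ℝ F] [NormedAddCommGroup G] [NormedSpace ℝ G]

theorem hasFDerivAt_fderiv_of_contDiffAt_two {f : E → F} {p : E} (hf : ContDiffAt ℝ 2 f p) :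
    HasFDerivAt (fderiv ℝ f) (fderiv ℝ (fderiv ℝ f) p) p :=
  ((hf.fderiv_right (m := 1) (by norm_num)).differentiableAt one_ne_zero).hasFDerivAt

theorem eventually_differentiableAt_of_contDiffAt_two {f : E → F} {p : E}
    (hf : ContDiffAt ℝ 2 f p) : ∀ᶠ x in 𝓝 p, DifferentiableAt ℝ f x :=
  (hf.eventually (by simp)).mono fun _ hx => hx.differentiableAt two_ne_zero

theorem isLittleO_sub_sub_fderiv_fderiv {f : E → F} {p : E} (hf : ContDiffAt ℝ 2 f p)
    (hcrit : fderiv ℝ f p = 0) :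
    (fun x => f x - f p - (2⁻¹ : ℝ) • fderiv ℝ (fderiv ℝ f) p (x - p) (x - p)) =o[𝓝 p]
      fun x => ‖x - p‖ ^ 2 := by
  set H := fderiv ℝ (fderiv ℝ f) p
  have hH (x w : E) : (2⁻¹ : ℝ) • (H (x - p) w + H w (x - p)) = H (x - p) w := by
    rw [(hf.isSymmSndFDerivAt (by simp)).eq w, ← two_smul ℝ, inv_smul_smul₀ two_ne_zero]
  obtain ⟨r, hr, hdiff⟩ := Metric.eventually_nhds_iff_ball.mp
    (eventually_differentiableAt_of_contDiffAt_two hf)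
  have hball := Metric.ball_mem_nhds p hr
  have hderiv (x : E) (hx : x ∈ Metric.ball p r) :
      HasFDerivAt (fun x => f x - (2⁻¹ : ℝ) • H (x - p) (x - p)) (fderiv ℝ f x - H (x - p)) x := by
    have hsub : HasFDerivAt (fun x => x - p) (ContinuousLinearMap.id ℝ E) x :=
      (hasFDerivAt_id x).sub_const p
    refine ((hdiff x hx).hasFDerivAt.sub
      (((H.hasFDerivAt.comp x hsub).clm_apply hsub).const_smul (2⁻¹ : ℝ))).congr_fderiv ?_
    ext w
    simpa using hH x w
  have hlittleO : (fun x => fderiv ℝ f x - H (x - p)) =o[𝓝 p] fun x => ‖x - p‖ ^ 1 := by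
    simpa [hcrit] using (hasFDerivAt_fderiv_of_contDiffAt_two hf).isLittleO.norm_right
  have := (convex_ball p r).isLittleO_pow_succ (Metric.mem_ball_self hr)
    (fun x hx => (hderiv x hx).hasFDerivWithinAt) (hlittleO.mono nhdsWithin_le_nhds)
  rw [nhdsWithin_eq_nhds.mpr hball] at this
  simpa [sub_right_comm] using this

/-- Since `p` is critical for `f`, the second-order behaviour of `γ` does not contribute. -/
theorem fderiv_fderiv_apply_self_of_isLittleO {f : E → F} {p u : E} {c : F}
    (hf : ContDiffAt ℝ 2 f p) (hcrit : fderiv ℝ f p = 0) {γ : ℝ → E} (hγ : HasDerivAt γ u 0)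
    (hγ₀ : γ 0 = p) (hfγ : (fun t => f (γ t) - f p - t ^ 2 • c) =o[𝓝 0] fun t : ℝ => t ^ 2) :
    fderiv ℝ (fderiv ℝ f) p u u = (2 : ℝ) • c := by
  subst hγ₀
  set H := fderiv ℝ (fderiv ℝ f) (γ 0)
  have hO : (fun t => ‖γ t - γ 0‖ ^ 2) =O[𝓝 0] fun t : ℝ => t ^ 2 := by
    simpa using (hγ.isBigO_sub.norm_left).pow 2
  have hrem : (fun t => t ^ 2 • c - (2⁻¹ : ℝ) • H (γ t - γ 0) (γ t - γ 0)) =o[𝓝 0]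
      fun t : ℝ => t ^ 2 := by
    have := ((isLittleO_sub_sub_fderiv_fderiv hf hcrit).comp_tendsto
      hγ.continuousAt.tendsto).trans_isBigO hO
    simpa [Function.comp_def] using this.sub hfγ
  have hslope : Tendsto (fun t : ℝ => t⁻¹ • (γ t - γ 0)) (𝓝[≠] 0) (𝓝 u) := by
    simpa using hγ.tendsto_slope_zero
  have hquad : Tendsto (fun t : ℝ => c - (2⁻¹ : ℝ) • H (t⁻¹ • (γ t - γ 0)) (t⁻¹ • (γ t - γ 0)))
      (𝓝[≠] 0) (𝓝 (c - (2⁻¹ : ℝ) • H u u)) :=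
    ((by fun_prop : Continuous fun y => c - (2⁻¹ : ℝ) • H y y).tendsto u).comp hslope
  have hzero : Tendsto (fun t : ℝ => c - (2⁻¹ : ℝ) • H (t⁻¹ • (γ t - γ 0)) (t⁻¹ • (γ t - γ 0)))
      (𝓝[≠] 0) (𝓝 0) := by
    refine (hrem.mono nhdsWithin_le_nhds).tendsto_inv_smul_nhds_zero.congr' ?_
    filter_upwards [self_mem_nhdsWithin] with t ht
    have ht : t ≠ 0 := ht
    rw [map_smul, map_smul, _root_.smul_apply, smul_smul t⁻¹, ← mul_inv, ← sq, smul_sub,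
      inv_smul_smul₀ (pow_ne_zero 2 ht), smul_comm]
  rw [sub_eq_zero.mp (tendsto_nhds_unique hquad hzero), smul_inv_smul₀ two_ne_zero]

theorem fderiv_fderiv_comp {f : E → F} {g : F → G} {p : E} (hg : ContDiffAt ℝ 2 g (f p))
    (hf : ContDiffAt ℝ 2 f p) (u v : E) : fderiv ℝ (fderiv ℝ (g ∘ f)) p u v =
      fderiv ℝ (fderiv ℝ g) (f p) (fderiv ℝ f p u) (fderiv ℝ f p v) +
        fderiv ℝ g (f p) (fderiv ℝ (fderiv ℝ f) p u v) := by
  have hfp := hf.differentiableAt two_ne_zero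
  have hchain : fderiv ℝ (g ∘ f) =ᶠ[𝓝 p] fun x => (fderiv ℝ g ∘ f) x ∘L fderiv ℝ f x := by
    filter_upwards [eventually_differentiableAt_of_contDiffAt_two hf,
      hfp.continuousAt.eventually (eventually_differentiableAt_of_contDiffAt_two hg)] with x hx hgx
    exact fderiv_comp x hgx hx
  have hderiv := ((hasFDerivAt_fderiv_of_contDiffAt_two hg).comp p hfp.hasFDerivAt).clm_comp
    (hasFDerivAt_fderiv_of_contDiffAt_two hf)
  rw [hchain.fderiv_eq, HasFDerivAt.fderiv hderiv]
  simp [add_comm]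

theorem fderiv_fderiv_clm_comp {f : E → F} {p : E} (hf : ContDiffAt ℝ 2 f p) (T : F →L[ℝ] G)
    (u v : E) : fderiv ℝ (fderiv ℝ (⇑T ∘ f)) p u v =
      T (fderiv ℝ (fderiv ℝ f) p u v) := by
  have h := T.iteratedFDeriv_comp_left hf (i := 2) le_rfl
  simpa [iteratedFDeriv_two_apply] using congrArg (fun L => L ![u, v]) h

theorem fderiv_fderiv_sub {f g : E → F} {p : E} (hf : ContDiffAt ℝ 2 f p)
    (hg : ContDiffAt ℝ 2 g p) : fderiv ℝ (fderiv ℝ (f - g)) p =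
      fderiv ℝ (fderiv ℝ f) p - fderiv ℝ (fderiv ℝ g) p := by
  have h : fderiv ℝ (f - g) =ᶠ[𝓝 p] fderiv ℝ f - fderiv ℝ g := by
    filter_upwards [eventually_differentiableAt_of_contDiffAt_two hf,
      eventually_differentiableAt_of_contDiffAt_two hg] with x hx hgx using fderiv_sub hx hgx
  rw [h.fderiv_eq, fderiv_sub (hasFDerivAt_fderiv_of_contDiffAt_two hf).differentiableAt
    (hasFDerivAt_fderiv_of_contDiffAt_two hg).differentiableAt]

end CriticalPoints

section LevelSets

variable {E F G : Type*} [NormedAddCommGroup E] [NormedSpace ℝ E] [CompleteSpace E]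
  [NormedAddCommGroup F] [NormedSpace ℝ F] [FiniteDimensional ℝ F] [NormedAddCommGroup G]
  [NormedSpace ℝ G]

theorem exists_hasDerivAt_of_mem_ker {f : E → F} {f' : E →L[ℝ] F} {p u : E}
    (hf : HasStrictFDerivAt f f' p) (hsurj : f'.range = ⊤) (hu : f' u = 0) :
    ∃ γ : ℝ → E, γ 0 = p ∧ HasDerivAt γ u 0 ∧ ∀ᶠ t in 𝓝 0, f (γ t) = f p := by
  have hline : HasDerivAt (fun t : ℝ => t • (⟨u, hu⟩ : f'.ker)) ⟨u, hu⟩ 0 := by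
    simpa using (hasDerivAt_id (0 : ℝ)).smul_const (⟨u, hu⟩ : f'.ker)
  refine ⟨fun t => hf.implicitFunction f f' hsurj (f p) (t • ⟨u, hu⟩), by simp, ?_, ?_⟩
  · refine HasFDerivAt.comp_hasDerivAt (l' := f'.ker.subtypeL) (0 : ℝ) ?_ hline
    rw [zero_smul]
    exact (hf.to_implicitFunction hsurj).hasFDerivAt
  · have htendsto : Filter.Tendsto (fun t : ℝ => (f p, t • (⟨u, hu⟩ : f'.ker))) (𝓝 0)
        (𝓝 (f p, 0)) := by
      simpa [ContinuousAt] using (continuousAt_const (y := f p)).prodMk hline.continuousAt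
    exact htendsto.eventually (hf.map_implicitFunction_eq hsurj)

variable {f : E → F} {g : E → G} {p : E}

theorem fderiv_apply_eq_zero_of_constant_on_levelSet (hf : ContDiffAt ℝ 2 f p)
    (hsurj : (fderiv ℝ f p).range = ⊤) (hg : ContDiffAt ℝ 2 g p)
    (hfg : ∀ᶠ x in 𝓝 p, f x = f p → g x = g p) {u : E} (hu : fderiv ℝ f p u = 0) :
    fderiv ℝ g p u = 0 := by
  obtain ⟨γ, rfl, hγ, hfγ⟩ :=
    exists_hasDerivAt_of_mem_ker (hf.hasStrictFDerivAt two_ne_zero) hsurj hu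
  have hgγ := (hg.differentiableAt two_ne_zero).hasFDerivAt.comp_hasDerivAt (0 : ℝ) hγ
  refine hgγ.unique ((hasDerivAt_const (0 : ℝ) (g (γ 0))).congr_of_eventuallyEq ?_)
  filter_upwards [hγ.continuousAt.eventually hfg, hfγ] with t ht htf using ht htf

theorem fderiv_fderiv_apply_self_of_constant_on_levelSet (hf : ContDiffAt ℝ 2 f p)
    (hsurj : (fderiv ℝ f p).range = ⊤) (hg : ContDiffAt ℝ 2 g p)
    (hfg : ∀ᶠ x in 𝓝 p, f x = f p → g x = g p) {T : F →L[ℝ] G}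
    (hT : ∀ v, T (fderiv ℝ f p v) = fderiv ℝ g p v) {u : E} (hu : fderiv ℝ f p u = 0) :
    fderiv ℝ (fderiv ℝ g) p u u = T (fderiv ℝ (fderiv ℝ f) p u u) := by
  obtain ⟨γ, hγ₀, hγ, hfγ⟩ :=
    exists_hasDerivAt_of_mem_ker (hf.hasStrictFDerivAt two_ne_zero) hsurj hu
  have hTf : ContDiffAt ℝ 2 (⇑T ∘ f) p := T.contDiff.contDiffAt.comp p hf
  have hcrit : fderiv ℝ (g - ⇑T ∘ f) p = 0 := by
    have hTfp := T.hasFDerivAt.comp p (hf.differentiableAt two_ne_zero).hasFDerivAt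
    ext v
    rw [((hg.differentiableAt two_ne_zero).hasFDerivAt.sub hTfp).fderiv]
    simp [hT]
  have hconst : ∀ᶠ t in 𝓝 0, (g - ⇑T ∘ f) (γ t) = (g - ⇑T ∘ f) p := by
    subst hγ₀
    filter_upwards [hγ.continuousAt.eventually hfg, hfγ] with t ht htf
    simp [ht htf, htf]
  have hzero := fderiv_fderiv_apply_self_of_isLittleO (f := g - ⇑T ∘ f) (c := 0) (hg.sub hTf)
    hcrit hγ hγ₀
    ((Asymptotics.isLittleO_zero _ _).congr' (hconst.mono fun t ht => by simp [← ht]) .rfl)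
  rw [fderiv_fderiv_sub hg hTf, smul_zero, _root_.sub_apply, _root_.sub_apply,
    fderiv_fderiv_clm_comp hf, sub_eq_zero] at hzero
  exact hzero

end LevelSets

section LeviForm

variable {E F G : Type*} [NormedAddCommGroup E] [NormedSpace ℂ E] [NormedAddCommGroup F]
  [NormedSpace ℝ F] [NormedAddCommGroup G] [NormedSpace ℝ G]

/-- Four times the real part of the Levi form of `f` at `p`, expressed through the real Hessian so
that it makes sense for functions with values in a real vector space. -/
noncomputable def leviForm (f : E → F) (p v w : E) : F :=
  fderiv ℝ (fderiv ℝ f) p v w + fderiv ℝ (fderiv ℝ f) p (Complex.I • v) (Complex.I • w)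

theorem leviForm_add_self {f : E → F} {p : E} (hf : ContDiffAt ℝ 2 f p) (v w : E) :
    leviForm f p (v + w) (v + w) =
      leviForm f p v v + leviForm f p w w + (2 : ℝ) • leviForm f p v w := by
  have hsymm := (hf.isSymmSndFDerivAt (by simp)).eq
  simp only [leviForm, smul_add, map_add, _root_.add_apply, hsymm w v,
    hsymm (Complex.I • w) (Complex.I • v), two_smul]
  abel

theorem leviForm_sub {f g : E → F} {p : E} (hf : ContDiffAt ℝ 2 f p) (hg : ContDiffAt ℝ 2 g p)
    (v w : E) : leviForm (f - g) p v w = leviForm f p v w - leviForm g p v w := by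
  simp only [leviForm, fderiv_fderiv_sub hf hg, _root_.sub_apply]
  abel

theorem leviForm_clm_comp {f : E → F} {p : E} (hf : ContDiffAt ℝ 2 f p) (T : F →L[ℝ] G)
    (v w : E) : leviForm (T ∘ f) p v w = T (leviForm f p v w) := by
  simp only [leviForm, fderiv_fderiv_clm_comp hf, map_add]

theorem leviForm_eq_zero_of_contDiffAt_complex {F : Type*} [NormedAddCommGroup F]
    [NormedSpace ℂ F] {φ : E → F} {p : E} (hφ : ContDiffAt ℂ 2 φ p) (v w : E) :
    leviForm φ p v w = 0 := by
  have hcomplex (v w : E) : fderiv ℝ (fderiv ℝ φ) p v w = fderiv ℂ (fderiv ℂ φ) p v w := by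
    have h := ContDiffAt.restrictScalars_iteratedFDeriv (𝕜 := ℝ) (𝕜' := ℂ) (n := 2) hφ
    simpa [iteratedFDeriv_two_apply] using congrArg (fun L => L ![v, w]) h.symm
  rw [leviForm, hcomplex, hcomplex, map_smul, map_smul, _root_.smul_apply, smul_smul,
    Complex.I_mul_I, neg_one_smul, add_neg_cancel]

theorem fderiv_real_apply_eq_fderiv_complex {F : Type*} [NormedAddCommGroup F] [NormedSpace ℂ F]
    {φ : E → F} {p : E} (hφ : DifferentiableAt ℂ φ p) (v : E) :
    fderiv ℝ φ p v = fderiv ℂ φ p v := by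
  rw [hφ.fderiv_restrictScalars ℝ]
  rfl

theorem leviForm_comp {F : Type*} [NormedAddCommGroup F] [NormedSpace ℂ F] {φ : E → F} {g : F → G}
    {p : E} (hφ : ContDiffAt ℂ 2 φ p) (hg : ContDiffAt ℝ 2 g (φ p)) (v w : E) :
    leviForm (g ∘ φ) p v w = leviForm g (φ p) (fderiv ℂ φ p v) (fderiv ℂ φ p w) := by
  have hφ₀ := leviForm_eq_zero_of_contDiffAt_complex hφ v w
  simp only [leviForm, fderiv_fderiv_comp hg (hφ.restrict_scalars ℝ),
    fderiv_real_apply_eq_fderiv_complex (hφ.differentiableAt two_ne_zero), map_smul]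
    at hφ₀ ⊢
  rw [add_add_add_comm, ← map_add, hφ₀, map_zero, add_zero]

/-- The complex tangent space `{D = 0} ∩ i {D = 0}` of a level set whose differential is `D`. -/
def complexKer (D : E →L[ℝ] F) : Set E := {v | D v = 0 ∧ D (Complex.I • v) = 0}

theorem add_mem_complexKer {D : E →L[ℝ] F} {v w : E} (hv : v ∈ complexKer D)
    (hw : w ∈ complexKer D) : v + w ∈ complexKer D :=
  ⟨by rw [map_add, hv.1, hw.1, add_zero], by rw [smul_add, map_add, hv.2, hw.2, add_zero]⟩

theorem exists_comp_eq_of_ker_le [FiniteDimensional ℝ F] {D : E →L[ℝ] F} (hD : D.range = ⊤)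
    (D' : E →L[ℝ] G) (hker : ∀ v, D v = 0 → D' v = 0) : ∃ T : F →L[ℝ] G, ∀ v, T (D v) = D' v := by
  obtain ⟨s, hs⟩ := D.toLinearMap.exists_rightInverse_of_surjective hD
  refine ⟨(D'.toLinearMap ∘ₗ s).toContinuousLinearMap, fun v => ?_⟩
  have hsv : D (s (D v) - v) = 0 := by
    rw [map_sub, sub_eq_zero]
    exact LinearMap.congr_fun hs (D v)
  simpa [sub_eq_zero] using hker _ hsv

theorem leviForm_of_constant_on_levelSet [CompleteSpace E] [FiniteDimensional ℝ F] {f : E → F}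
    {g : E → G} {p : E} (hf : ContDiffAt ℝ 2 f p) (hsurj : (fderiv ℝ f p).range = ⊤)
    (hg : ContDiffAt ℝ 2 g p) (hfg : ∀ᶠ x in 𝓝 p, f x = f p → g x = g p) {T : F →L[ℝ] G}
    (hT : ∀ v, T (fderiv ℝ f p v) = fderiv ℝ g p v) {v w : E} (hv : v ∈ complexKer (fderiv ℝ f p))
    (hw : w ∈ complexKer (fderiv ℝ f p)) : leviForm g p v w = T (leviForm f p v w) := by
  have hself {u : E} (hu : u ∈ complexKer (fderiv ℝ f p)) :
      leviForm g p u u = T (leviForm f p u u) := by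
    simp only [leviForm, map_add,
      fderiv_fderiv_apply_self_of_constant_on_levelSet hf hsurj hg hfg hT hu.1,
      fderiv_fderiv_apply_self_of_constant_on_levelSet hf hsurj hg hfg hT hu.2]
  have hadd := hself (add_mem_complexKer hv hw)
  rw [leviForm_add_self hg, leviForm_add_self hf, map_add, map_add, map_smul, hself hv, hself hw,
    add_right_inj] at hadd
  exact smul_right_injective G two_ne_zero hadd

/-- No nonzero vector of the complex tangent space of the level set of `f` through `p` is
orthogonal to this space for the Levi form of `f`. -/
def IsLeviNondegenerateAt (f : E → F) (p : E) : Prop :=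
  ∀ v ∈ complexKer (fderiv ℝ f p), (∀ w ∈ complexKer (fderiv ℝ f p), leviForm f p v w = 0) → v = 0

theorem IsLeviNondegenerateAt.comp {F : Type*} [NormedAddCommGroup F] [NormedSpace ℂ F]
    {φ : E → F} {g : F → G} {p : E} (hlevi : IsLeviNondegenerateAt g (φ p))
    (hφ : ContDiffAt ℂ 2 φ p) (hg : ContDiffAt ℝ 2 g (φ p))
    (hbij : Function.Bijective (fderiv ℂ φ p)) : IsLeviNondegenerateAt (g ∘ φ) p := by
  have hφp := hφ.differentiableAt two_ne_zero
  have hderiv (v : E) : fderiv ℝ (g ∘ φ) p v = fderiv ℝ g (φ p) (fderiv ℂ φ p v) := by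
    rw [fderiv_comp p (hg.differentiableAt two_ne_zero) (hφp.restrictScalars ℝ),
      ContinuousLinearMap.comp_apply, fderiv_real_apply_eq_fderiv_complex hφp]
  have hker (v : E) : v ∈ complexKer (fderiv ℝ (g ∘ φ) p) ↔
      fderiv ℂ φ p v ∈ complexKer (fderiv ℝ g (φ p)) := by
    simp only [complexKer, Set.mem_ofPred_eq, hderiv, map_smul]
  intro v hv hvw
  refine (map_eq_zero_iff _ hbij.injective).mp (hlevi _ ((hker v).mp hv) fun w' hw' => ?_)
  obtain ⟨w, rfl⟩ := hbij.surjective w'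
  rw [← leviForm_comp hφ hg]
  exact hvw w ((hker w).mpr hw')

theorem IsLeviNondegenerateAt.of_constant_on_levelSet [CompleteSpace E] [FiniteDimensional ℝ F]
    {f g : E → F} {p : E} (hlevi : IsLeviNondegenerateAt g p) (hf : ContDiffAt ℝ 2 f p)
    (hfsurj : (fderiv ℝ f p).range = ⊤) (hg : ContDiffAt ℝ 2 g p)
    (hgsurj : (fderiv ℝ g p).range = ⊤) (hfg : ∀ᶠ x in 𝓝 p, f x = f p → g x = g p) :
    IsLeviNondegenerateAt f p := by
  obtain ⟨T, hT⟩ := exists_comp_eq_of_ker_le hfsurj (fderiv ℝ g p) fun u hu =>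
    fderiv_apply_eq_zero_of_constant_on_levelSet hf hfsurj hg hfg hu
  have hTsurj : Function.Surjective T := fun y => by
    obtain ⟨v, rfl⟩ := LinearMap.range_eq_top.mp hgsurj y
    exact ⟨_, hT v⟩
  have hTinj : Function.Injective T :=
    LinearMap.injective_iff_surjective.mpr hTsurj
  have hker : complexKer (fderiv ℝ g p) = complexKer (fderiv ℝ f p) := by
    ext v
    simp only [complexKer, Set.mem_ofPred_eq, ← hT, map_eq_zero_iff T hTinj]
  intro v hv hvw
  refine hlevi v (hker ▸ hv) fun w hw => ?_
  rw [hker] at hw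
  rw [leviForm_of_constant_on_levelSet hf hfsurj hg hfg hT hv hw, hvw w hw, map_zero]

end LeviForm

section HermitianForms

open Asymptotics
open scoped ComplexOrder

variable {ι : Type*} [Fintype ι]

/-- The real quadratic form `Re (ᵗz̄ A z)`. -/
noncomputable def reQuad (A : Matrix ι ι ℂ) (z : ι → ℂ) : ℝ :=
  (star z ⬝ᵥ A *ᵥ z).re

theorem reQuad_smul (A : Matrix ι ι ℂ) (t : ℝ) (z : ι → ℂ) :
    reQuad A (t • z) = t ^ 2 * reQuad A z := by
  simp only [reQuad, star_smul, mulVec_smul, smul_dotProduct, dotProduct_smul,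
    Complex.real_smul, star_trivial, Complex.re_ofReal_mul]
  ring

theorem reQuad_I_smul (A : Matrix ι ι ℂ) (z : ι → ℂ) :
    reQuad A (Complex.I • z) = reQuad A z := by
  simp [reQuad, star_smul, mulVec_smul, smul_dotProduct, dotProduct_smul, ← mul_assoc]

theorem reQuad_add {A : Matrix ι ι ℂ} (hA : A.IsHermitian) (a b : ι → ℂ) :
    reQuad A (a + b) = reQuad A a + reQuad A b + 2 * (star b ⬝ᵥ A *ᵥ a).re := by
  have hstar : star a ⬝ᵥ A *ᵥ b = star (star b ⬝ᵥ A *ᵥ a) := by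
    rw [star_dotProduct, star_mulVec, hA.eq, dotProduct_mulVec]
  simp only [reQuad, star_add, mulVec_add, add_dotProduct, dotProduct_add, Complex.add_re, hstar,
    Complex.star_def, Complex.conj_re]
  ring

theorem mulVec_eq_zero_of_forall_re_eq_zero {A : Matrix ι ι ℂ} {z : ι → ℂ}
    (hz : ∀ b, (star b ⬝ᵥ A *ᵥ z).re = 0) : A *ᵥ z = 0 := by
  have hnonneg : 0 ≤ star (A *ᵥ z) ⬝ᵥ A *ᵥ z := dotProduct_star_self_nonneg _
  exact dotProduct_star_self_eq_zero.mp (Complex.ext (hz _) (Complex.nonneg_iff.mp hnonneg).2.symm)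

theorem contDiff_reQuad (A : Matrix ι ι ℂ) {m : WithTop ℕ∞} :
    ContDiff ℝ m (reQuad A) := by
  have hconj : ContDiff ℝ m fun c : ℂ => star c := Complex.conjCLE.contDiff
  have hmulVec : ContDiff ℝ m fun z => A *ᵥ z :=
    (A.mulVecLin.restrictScalars ℝ).toContinuousLinearMap.contDiff
  exact Complex.reCLM.contDiff.comp <| ContDiff.sum fun i _ =>
    (hconj.comp (contDiff_apply ℝ ℂ i)).mul ((contDiff_apply ℝ ℂ i).comp hmulVec)

theorem reQuad_isBigO (A : Matrix ι ι ℂ) : reQuad A =O[𝓝 0] fun z => ‖z‖ ^ 2 := by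
  have hmulVec : (fun z => A *ᵥ z) =O[𝓝 0] fun z => z :=
    A.mulVecLin.toContinuousLinearMap.isBigO_id _
  have hterm (i : ι) : (fun z => star (z i) * (A *ᵥ z) i) =O[𝓝 0] fun z => ‖z‖ * ‖z‖ :=
    (IsBigO.of_norm_le fun z => by simpa using norm_le_pi_norm z i).mul
      ((isBigO_pi.mp hmulVec i).norm_right)
  simp only [sq]
  exact (Complex.reCLM.isBigO_comp _ _).trans (.fun_sum fun i _ => hterm i)

end HermitianForms

section ReducedEquations

open Asymptotics Filter

variable {n d : ℕ}

/-- The real linear map `w ↦ Re w` on `ℂ^d`. -/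
noncomputable def rePart : (Fin d → ℂ) →L[ℝ] (Fin d → ℝ) :=
  .pi fun k => Complex.reCLM ∘L .proj k

/-- The real linear map `w ↦ Im w` on `ℂ^d`. -/
noncomputable def imPart : (Fin d → ℂ) →L[ℝ] (Fin d → ℝ) :=
  .pi fun k => Complex.imCLM ∘L .proj k

/-- The right-hand side `ᵗz̄ A_k z + h_k(z, Re w)` of the reduced equations as a function of
`(z, w)`. -/
noncomputable def reducedGraph (A : Fin d → Matrix (Fin n) (Fin n) ℂ)
    (h : (Fin n → ℂ) × (Fin d → ℝ) → Fin d → ℝ) (x : (Fin n → ℂ) × (Fin d → ℂ)) : Fin d → ℝ :=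
  fun k => reQuad (A k) x.1 + h (x.1, rePart x.2) k

variable {A : Fin d → Matrix (Fin n) (Fin n) ℂ} {h : (Fin n → ℂ) × (Fin d → ℝ) → Fin d → ℝ}

theorem eq_zero_at_zero_of_isLittleO
    (hh : h =o[𝓝 0] fun x : (Fin n → ℂ) × (Fin d → ℝ) => ‖x.1‖ ^ 2 + ‖x.2‖) : h 0 = 0 :=
  hh.isBigO.eq_zero_imp.self_of_nhds (by simp)

theorem reducedGraph_zero (hh₀ : h 0 = 0) : reducedGraph A h 0 = 0 := by
  have hh₀' : h (0, 0) = 0 := hh₀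
  ext k
  simp [reducedGraph, reQuad, hh₀']

theorem contDiffAt_reducedGraph (hh : ContDiffAt ℝ 2 h 0) :
    ContDiffAt ℝ 2 (reducedGraph A h) 0 := by
  have hre : ContDiff ℝ 2 fun x : (Fin n → ℂ) × (Fin d → ℂ) => (x.1, rePart x.2) :=
    contDiff_fst.prodMk (rePart.contDiff.comp contDiff_snd)
  have hh' : ContDiffAt ℝ 2 (fun x : (Fin n → ℂ) × (Fin d → ℂ) => h (x.1, rePart x.2)) 0 :=
    ContDiffAt.comp (g := h) 0 (by simpa [Prod.mk_zero_zero] using hh) hre.contDiffAt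
  exact contDiffAt_pi.mpr fun k =>
    ((contDiff_reQuad (A k)).comp contDiff_fst).contDiffAt.add (contDiffAt_pi.mp hh' k)

theorem fderiv_reducedGraph
    (hh : h =o[𝓝 0] fun x : (Fin n → ℂ) × (Fin d → ℝ) => ‖x.1‖ ^ 2 + ‖x.2‖) :
    fderiv ℝ (reducedGraph A h) 0 = 0 := by
  have hsq : (fun x : (Fin n → ℂ) × (Fin d → ℂ) => ‖x.1‖ ^ 2) =o[𝓝 0] fun x => x :=
    ((isLittleO_norm_pow_id one_lt_two).comp_tendsto (continuous_fst.tendsto' 0 0 rfl)).trans_isBigO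
      isBigO_fst_prod'
  have hQ (k : Fin d) : (fun x : (Fin n → ℂ) × (Fin d → ℂ) => reQuad (A k) x.1) =o[𝓝 0]
      fun x => x :=
    ((reQuad_isBigO (A k)).comp_tendsto (continuous_fst.tendsto' 0 0 rfl)).trans_isLittleO hsq
  have hre : (fun x : (Fin n → ℂ) × (Fin d → ℂ) => rePart x.2) =O[𝓝 0] fun x => x :=
    (rePart.isBigO_comp _ _).trans isBigO_snd_prod'
  have hh' : (fun x : (Fin n → ℂ) × (Fin d → ℂ) => h (x.1, rePart x.2)) =o[𝓝 0] fun x => x :=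
    (hh.comp_tendsto (Continuous.tendsto' (by fun_prop) 0 0 (by simp))).trans_isBigO
      (hsq.isBigO.add hre.norm_left)
  have hr : reducedGraph A h =o[𝓝 0] fun x => x :=
    isLittleO_pi.mpr fun k => (hQ k).add (isLittleO_pi.mp hh' k)
  refine HasFDerivAt.fderiv (.of_isLittleO ?_)
  simpa [reducedGraph_zero (eq_zero_at_zero_of_isLittleO hh)] using hr

theorem leviForm_reducedGraph (hA : ∀ k, (A k).IsHermitian) (hh : ContDiffAt ℝ 2 h 0)
    (hho : h =o[𝓝 0] fun x : (Fin n → ℂ) × (Fin d → ℝ) => ‖x.1‖ ^ 2 + ‖x.2‖)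
    (a b : Fin n → ℂ) (k : Fin d) :
    leviForm (reducedGraph A h) 0 (a, 0) (b, 0) k = 4 * (star b ⬝ᵥ A k *ᵥ a).re := by
  have hcrit : fderiv ℝ (reducedGraph A h) 0 = 0 := fderiv_reducedGraph hho
  have hr := contDiffAt_reducedGraph (A := A) hh
  have hsecond (z : Fin n → ℂ) : fderiv ℝ (fderiv ℝ (reducedGraph A h)) 0 (z, 0) (z, 0) =
      (2 : ℝ) • fun k => reQuad (A k) z := by
    have hline : HasDerivAt (fun t : ℝ => t • (z, (0 : Fin d → ℂ))) (z, 0) 0 := by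
      simpa using (hasDerivAt_id (0 : ℝ)).smul_const (z, (0 : Fin d → ℂ))
    refine fderiv_fderiv_apply_self_of_isLittleO hr hcrit hline (zero_smul ℝ _) ?_
    have hho' : (fun t : ℝ => h (t • z, 0)) =o[𝓝 0] fun t : ℝ => t ^ 2 := by
      have hlim : Tendsto (fun t : ℝ => (t • z, (0 : Fin d → ℝ))) (𝓝 0) (𝓝 0) :=
        Continuous.tendsto' (by fun_prop) 0 0 (by simp)
      refine (hho.comp_tendsto hlim).trans_isBigO (.of_bound (‖z‖ ^ 2) (.of_forall fun t => ?_))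
      simp [norm_smul, mul_pow, mul_comm]
    refine hho'.congr_left fun t => ?_
    ext k
    simp [reducedGraph_zero (eq_zero_at_zero_of_isLittleO hho), reducedGraph, reQuad_smul]
  have hself (z : Fin n → ℂ) :
      leviForm (reducedGraph A h) 0 (z, 0) (z, 0) = (4 : ℝ) • fun k => reQuad (A k) z := by
    have hI : Complex.I • (z, (0 : Fin d → ℂ)) = (Complex.I • z, 0) := by simp
    rw [leviForm, hI, hsecond, hsecond]
    ext k
    simp only [Pi.add_apply, Pi.smul_apply, smul_eq_mul, reQuad_I_smul]
    ring
  have hadd := congrFun (leviForm_add_self hr (a, 0) (b, 0)) k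
  rw [Prod.mk_add_mk, add_zero, hself, hself, hself] at hadd
  simp only [Pi.add_apply, Pi.smul_apply, smul_eq_mul, reQuad_add (hA k)] at hadd
  linarith

/-- The function `Im w_k - ᵗz̄ A_k z - h_k(z, Re w)` whose zero set is given by the reduced
equations. -/
noncomputable def reducedDefiningFunction (A : Fin d → Matrix (Fin n) (Fin n) ℂ)
    (h : (Fin n → ℂ) × (Fin d → ℝ) → Fin d → ℝ) : (Fin n → ℂ) × (Fin d → ℂ) → Fin d → ℝ :=
  ⇑imPart ∘ Prod.snd - reducedGraph A h

theorem contDiffAt_reducedDefiningFunction (hh : ContDiffAt ℝ 2 h 0) :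
    ContDiffAt ℝ 2 (reducedDefiningFunction A h) 0 :=
  (imPart.contDiff.comp contDiff_snd).contDiffAt.sub (contDiffAt_reducedGraph hh)

theorem fderiv_reducedDefiningFunction (hh : ContDiffAt ℝ 2 h 0)
    (hho : h =o[𝓝 0] fun x : (Fin n → ℂ) × (Fin d → ℝ) => ‖x.1‖ ^ 2 + ‖x.2‖) :
    fderiv ℝ (reducedDefiningFunction A h) 0 = imPart ∘L .snd ℝ _ _ := by
  have hgraph := (contDiffAt_reducedGraph (A := A) hh).differentiableAt two_ne_zero
  have him := (imPart (d := d) ∘L .snd ℝ (Fin n → ℂ) (Fin d → ℂ)).hasFDerivAt (x := 0)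
  refine (him.sub hgraph.hasFDerivAt).fderiv.trans ?_
  rw [fderiv_reducedGraph hho, sub_zero]

theorem range_imPart_comp_snd :
    (imPart ∘L .snd ℝ (Fin n → ℂ) (Fin d → ℂ)).range = ⊤ :=
  LinearMap.range_eq_top.mpr fun y => ⟨(0, fun k => y k * Complex.I), by ext k; simp [imPart]⟩

theorem mem_complexKer_imPart_comp_snd {x : (Fin n → ℂ) × (Fin d → ℂ)} :
    x ∈ complexKer (imPart ∘L .snd ℝ _ _) ↔ x.2 = 0 := by
  simp [complexKer, imPart, funext_iff, Complex.ext_iff, forall_and, and_comm]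

theorem leviForm_reducedDefiningFunction (hA : ∀ k, (A k).IsHermitian) (hh : ContDiffAt ℝ 2 h 0)
    (hho : h =o[𝓝 0] fun x : (Fin n → ℂ) × (Fin d → ℝ) => ‖x.1‖ ^ 2 + ‖x.2‖)
    (a b : Fin n → ℂ) (k : Fin d) :
    leviForm (reducedDefiningFunction A h) 0 (a, 0) (b, 0) k =
      -4 * (star b ⬝ᵥ A k *ᵥ a).re := by
  have hsnd : ContDiffAt ℂ 2 (Prod.snd : (Fin n → ℂ) × (Fin d → ℂ) → _) 0 := contDiffAt_snd
  rw [reducedDefiningFunction, leviForm_sub (imPart.contDiff.comp contDiff_snd).contDiffAt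
    (contDiffAt_reducedGraph hh), leviForm_clm_comp (hsnd.restrict_scalars ℝ),
    leviForm_eq_zero_of_contDiffAt_complex hsnd, map_zero, zero_sub, Pi.neg_apply,
    leviForm_reducedGraph hA hh hho, neg_mul]

theorem isLeviNondegenerateAt_reducedDefiningFunction (hA : ∀ k, (A k).IsHermitian)
    (hh : ContDiffAt ℝ 2 h 0)
    (hho : h =o[𝓝 0] fun x : (Fin n → ℂ) × (Fin d → ℝ) => ‖x.1‖ ^ 2 + ‖x.2‖)
    (hb : ConditionB A) : IsLeviNondegenerateAt (reducedDefiningFunction A h) 0 := by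
  rintro ⟨a, w⟩ hv hlevi
  rw [fderiv_reducedDefiningFunction hh hho] at hv hlevi
  obtain rfl : w = 0 := mem_complexKer_imPart_comp_snd.mp hv
  have hker (k : Fin d) : A k *ᵥ a = 0 := mulVec_eq_zero_of_forall_re_eq_zero fun b => by
    have hk := congrFun (hlevi (b, 0) (mem_complexKer_imPart_comp_snd.mpr rfl)) k
    simpa [leviForm_reducedDefiningFunction hA hh hho] using hk
  have ha : a ∈ ⨅ k, LinearMap.ker (A k).mulVecLin := by simpa [Submodule.mem_iInf] using hker
  rw [(Submodule.mem_bot ℂ).mp (hb.le ha), Prod.mk_zero_zero]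

end ReducedEquations

section TaylorCoefficients

open Finsupp

variable {N : ℕ}

theorem iterD_zero (D : Fin N → ((Fin N → ℂ) → ℂ) → ((Fin N → ℂ) → ℂ)) (f : (Fin N → ℂ) → ℂ) :
    iterD D (fun _ => 0) f = f :=
  List.foldr_fixed _

theorem foldr_iterate_single {ι B : Type*} [DecidableEq ι] (D : ι → B → B) (b : B) (j : ι)
    {l : List ι} (hl : l.Nodup) :
    l.foldr (fun i => (D i)^[(Pi.single j 1 : ι → ℕ) i]) b = if j ∈ l then D j b else b := by
  induction l with
  | nil => rfl
  | cons i l ih =>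
    rw [List.nodup_cons] at hl
    rw [List.foldr_cons, ih hl.2]
    rcases eq_or_ne i j with rfl | hij
    · simp [hl.1]
    · simp [hij, hij.symm]

theorem iterD_single (D : Fin N → ((Fin N → ℂ) → ℂ) → ((Fin N → ℂ) → ℂ)) (f : (Fin N → ℂ) → ℂ)
    (j : Fin N) : iterD D (Pi.single j 1) f = D j f := by
  rw [iterD, foldr_iterate_single D f j (List.nodup_finRange N), if_pos (List.mem_finRange j)]

variable (f : (Fin N → ℂ) → ℂ) (p : Fin N → ℂ)

theorem coeff_taylorSeries_of_le_one {m : Fin N ⊕ Fin N →₀ ℕ} (hm : ∀ s, m s ≤ 1) :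
    MvPowerSeries.coeff m (taylorSeries f p) =
      iterD dZ (fun j => m (Sum.inl j)) (iterD dZbar (fun l => m (Sum.inr l)) f) p := by
  change taylorSeries f p m = _
  rw [taylorSeries, Finset.prod_eq_one fun s _ => Nat.factorial_eq_one.mpr (hm s), Nat.cast_one,
    div_one]

theorem constantCoeff_taylorSeries :
    MvPowerSeries.constantCoeff (taylorSeries f p) = f p := by
  rw [← MvPowerSeries.coeff_zero_eq_constantCoeff_apply, coeff_taylorSeries_of_le_one f p (by simp)]
  exact congrFun ((iterD_zero dZ _).trans (iterD_zero dZbar f)) p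

theorem single_apply_le_one {σ : Type*} (s t : σ) : single s 1 t ≤ 1 := by
  classical
  rw [Finsupp.single_apply]
  split_ifs <;> simp

theorem holGrad_taylorSeries : holGrad (taylorSeries f p) = fun j => dZ j f p := by
  ext j
  have hj : (fun i => single (Sum.inl j : Fin N ⊕ Fin N) 1 (Sum.inl i)) = Pi.single j 1 := by
    ext i
    simp [Finsupp.single_apply, Pi.single_apply, eq_comm]
  rw [holGrad, coeff_taylorSeries_of_le_one f p (single_apply_le_one _), hj, iterD_single]
  simpa using congrFun (congrArg (dZ j) (iterD_zero dZbar f)) p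

theorem antiholGrad_taylorSeries : antiholGrad (taylorSeries f p) = fun l => dZbar l f p := by
  ext l
  have hl : (fun i => single (Sum.inr l : Fin N ⊕ Fin N) 1 (Sum.inr i)) = Pi.single l 1 := by
    ext i
    simp [Finsupp.single_apply, Pi.single_apply, eq_comm]
  rw [antiholGrad, coeff_taylorSeries_of_le_one f p (single_apply_le_one _), hl, iterD_single]
  simpa using congrFun (iterD_zero dZ (dZbar l f)) p

theorem leviMatrix_taylorSeries :
    leviMatrix (taylorSeries f p) = Matrix.of fun j l => dZ j (dZbar l f) p := by
  ext j l
  set m : Fin N ⊕ Fin N →₀ ℕ := single (Sum.inl j) 1 + single (Sum.inr l) 1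
  have hj : (fun i => m (Sum.inl i)) = Pi.single j 1 := by
    ext i
    simp [m, Finsupp.single_apply, Pi.single_apply, eq_comm]
  have hl : (fun i => m (Sum.inr i)) = Pi.single l 1 := by
    ext i
    simp [m, Finsupp.single_apply, Pi.single_apply, eq_comm]
  have hm (s : Fin N ⊕ Fin N) : m s ≤ 1 := by
    rcases s with i | i
    · simpa [m] using single_apply_le_one (Sum.inl j) (Sum.inl i)
    · simpa [m] using single_apply_le_one (Sum.inr l) (Sum.inr i)
  refine (coeff_taylorSeries_of_le_one f p hm).trans ?_
  rw [hj, hl, iterD_single, iterD_single]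
  rfl

end TaylorCoefficients

section Wirtinger

theorem pi_apply_eq_sum_smul_single {R S M ι : Type*} [Semiring R] [Semiring S] [AddCommMonoid M]
    [Module S M] [Fintype ι] [DecidableEq ι] {σ : R →+* S} (g : (ι → R) →ₛₗ[σ] M) (v : ι → R) :
    g v = ∑ i, σ (v i) • g (Pi.single i 1) := by
  conv_lhs => rw [pi_eq_sum_univ' v, map_sum]
  simp only [map_smulₛₗ]

section

variable {E : Type*} [NormedAddCommGroup E] [NormedSpace ℂ E]

theorem complex_smul_eq_re_add_im (c : ℂ) (v : E) : c • v = c.re • v + c.im • Complex.I • v := by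
  conv_lhs => rw [← Complex.re_add_im c, add_smul, mul_smul]
  simp only [Complex.coe_smul]

/-- The complex linear part `∂g` in the decomposition `g = ∂g + ∂̄g` of a real linear form. -/
noncomputable def holPart (g : E →L[ℝ] ℂ) : E →ₗ[ℂ] ℂ where
  toFun v := (1 / 2 : ℂ) * (g v - Complex.I * g (Complex.I • v))
  map_add' v w := by
    simp only [smul_add, map_add]
    ring
  map_smul' c v := by
    rw [smul_comm Complex.I c v, complex_smul_eq_re_add_im c v, complex_smul_eq_re_add_im c]
    simp only [map_add, map_smul, smul_smul Complex.I, Complex.I_mul_I, neg_one_smul, map_neg,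
      Complex.real_smul, smul_eq_mul, RingHom.id_apply]
    conv_rhs => rw [← Complex.re_add_im c]
    linear_combination (1 / 2 * c.im * g (Complex.I • v)) * Complex.I_mul_I

/-- The antilinear part `∂̄g` in the decomposition `g = ∂g + ∂̄g` of a real linear form. -/
noncomputable def antiholPart (g : E →L[ℝ] ℂ) : E →ₛₗ[starRingEnd ℂ] ℂ where
  toFun v := (1 / 2 : ℂ) * (g v + Complex.I * g (Complex.I • v))
  map_add' v w := by
    simp only [smul_add, map_add]
    ring
  map_smul' c v := by
    rw [smul_comm Complex.I c v, complex_smul_eq_re_add_im c v, complex_smul_eq_re_add_im c]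
    simp only [map_add, map_smul, smul_smul Complex.I, Complex.I_mul_I, neg_one_smul, map_neg,
      Complex.real_smul, smul_eq_mul]
    conv_rhs => rw [← Complex.re_add_im c]
    simp only [map_add, map_mul, Complex.conj_ofReal, Complex.conj_I]
    linear_combination (1 / 2 * c.im * g (Complex.I • v)) * Complex.I_mul_I

theorem holPart_apply (g : E →L[ℝ] ℂ) (v : E) :
    holPart g v = 1 / 2 * (g v - Complex.I * g (Complex.I • v)) :=
  rfl

theorem antiholPart_apply (g : E →L[ℝ] ℂ) (v : E) :
    antiholPart g v = 1 / 2 * (g v + Complex.I * g (Complex.I • v)) :=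
  rfl

theorem hasFDerivAt_antiholPart_fderiv {f : E → ℂ} {p : E} (hf : ContDiffAt ℝ 2 f p) (y : E) :
    HasFDerivAt (fun Z => antiholPart (fderiv ℝ f Z) y) ((1 / 2 : ℂ) •
      ((fderiv ℝ (fderiv ℝ f) p).flip y +
        Complex.I • (fderiv ℝ (fderiv ℝ f) p).flip (Complex.I • y))) p := by
  have hderiv (w : E) :
      HasFDerivAt (fun Z => fderiv ℝ f Z w) ((fderiv ℝ (fderiv ℝ f) p).flip w) p := by
    simpa using (hasFDerivAt_fderiv_of_contDiffAt_two hf).clm_apply (hasFDerivAt_const w p)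
  exact ((hderiv y).add ((hderiv (Complex.I • y)).const_smul Complex.I)).const_smul (1 / 2 : ℂ)

theorem holPart_fderiv_antiholPart_fderiv {f : E → ℂ} {p : E} (hf : ContDiffAt ℝ 2 f p)
    (v y : E) : holPart (fderiv ℝ (fun Z => antiholPart (fderiv ℝ f Z) y) p) v =
      1 / 4 * (leviForm f p v y + Complex.I * leviForm f p v (Complex.I • y)) := by
  rw [(hasFDerivAt_antiholPart_fderiv hf y).fderiv, holPart_apply]
  simp only [leviForm, smul_smul, Complex.I_mul_I, neg_one_smul, map_neg, _root_.smul_apply,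
    _root_.add_apply, ContinuousLinearMap.flip_apply, smul_eq_mul]
  linear_combination (-1 / 4 * fderiv ℝ (fderiv ℝ f) p (Complex.I • v) (Complex.I • y)) *
    Complex.I_mul_I

end

variable {N : ℕ}

theorem dZ_eq_holPart (f : (Fin N → ℂ) → ℂ) (Z : Fin N → ℂ) (j : Fin N) :
    dZ j f Z = holPart (fderiv ℝ f Z) (Pi.single j 1) := by
  simp [dZ, holPart_apply, ← Pi.single_smul]

theorem dZbar_eq_antiholPart (f : (Fin N → ℂ) → ℂ) (Z : Fin N → ℂ) (l : Fin N) :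
    dZbar l f Z = antiholPart (fderiv ℝ f Z) (Pi.single l 1) := by
  simp [dZbar, antiholPart_apply, ← Pi.single_smul]

theorem dotProduct_dZ (f : (Fin N → ℂ) → ℂ) (Z v : Fin N → ℂ) :
    (v ⬝ᵥ fun j => dZ j f Z) = holPart (fderiv ℝ f Z) v := by
  simp only [dZ_eq_holPart]
  exact (pi_apply_eq_sum_smul_single (holPart (fderiv ℝ f Z)) v).symm

theorem star_dotProduct_dZbar (f : (Fin N → ℂ) → ℂ) (Z y : Fin N → ℂ) :
    (star y ⬝ᵥ fun l => dZbar l f Z) = antiholPart (fderiv ℝ f Z) y := by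
  simp only [dZbar_eq_antiholPart]
  exact (pi_apply_eq_sum_smul_single (antiholPart (fderiv ℝ f Z)) y).symm

theorem dZ_dotProduct {ι : Type*} [Fintype ι] {f : ι → (Fin N → ℂ) → ℂ} {p : Fin N → ℂ}
    (hf : ∀ l, DifferentiableAt ℝ (f l) p) (c : ι → ℂ) (j : Fin N) :
    dZ j (fun Z => c ⬝ᵥ fun l => f l Z) p = c ⬝ᵥ fun l => dZ j (f l) p := by
  have hsum : HasFDerivAt (fun Z => c ⬝ᵥ fun l => f l Z) (∑ l, c l • fderiv ℝ (f l) p) p :=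
    .fun_sum fun l _ => (hf l).hasFDerivAt.const_mul (c l)
  rw [dZ, hsum.fderiv]
  simp only [dZ, dotProduct, _root_.sum_apply, _root_.smul_apply, smul_eq_mul,
    Finset.mul_sum, ← Finset.sum_sub_distrib]
  exact Finset.sum_congr rfl fun l _ => by ring

theorem dotProduct_leviMatrix_mulVec_star {f : (Fin N → ℂ) → ℂ} {p : Fin N → ℂ}
    (hf : ContDiffAt ℝ 2 f p) (v y : Fin N → ℂ) :
    v ⬝ᵥ leviMatrix (taylorSeries f p) *ᵥ star y =
      1 / 4 * (leviForm f p v y + Complex.I * leviForm f p v (Complex.I • y)) := by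
  have hdiff (l : Fin N) : DifferentiableAt ℝ (dZbar l f) p := by
    rw [funext fun Z => dZbar_eq_antiholPart f Z l]
    exact (hasFDerivAt_antiholPart_fderiv hf _).differentiableAt
  rw [← holPart_fderiv_antiholPart_fderiv hf, ← dotProduct_dZ, leviMatrix_taylorSeries]
  congr 1
  ext j
  simp only [← star_dotProduct_dZbar]
  rw [dZ_dotProduct hdiff, dotProduct_comm]
  rfl

end Wirtinger

section RealDefiningFunctions

variable {E : Type*} [NormedAddCommGroup E] [NormedSpace ℂ E] {κ : Type*}
  {f : E → κ → ℝ} {p : E}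

theorem fderiv_ofReal_component [Finite κ] (hf : DifferentiableAt ℝ f p) (k : κ) (v : E) :
    fderiv ℝ (fun x => (f x k : ℂ)) p v = (fderiv ℝ f p v k : ℂ) := by
  cases nonempty_fintype κ
  exact DFunLike.congr_fun ((Complex.ofRealCLM ∘L .proj k :
    (κ → ℝ) →L[ℝ] ℂ).hasFDerivAt.comp p hf.hasFDerivAt).fderiv v

theorem leviForm_ofReal_component [Fintype κ] (hf : ContDiffAt ℝ 2 f p) (k : κ) (v w : E) :
    leviForm (fun x => (f x k : ℂ)) p v w = (leviForm f p v w k : ℂ) :=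
  leviForm_clm_comp hf (Complex.ofRealCLM ∘L .proj k) v w

theorem contDiffAt_ofReal_component [Fintype κ] {n : WithTop ℕ∞} (hf : ContDiffAt ℝ n f p) (k : κ) :
    ContDiffAt ℝ n (fun x => (f x k : ℂ)) p :=
  (Complex.ofRealCLM ∘L .proj k : (κ → ℝ) →L[ℝ] ℂ).contDiff.contDiffAt.comp p hf

theorem mem_complexKer_iff_holPart_eq_zero [Fintype κ] (hf : DifferentiableAt ℝ f p) {v : E} :
    v ∈ complexKer (fderiv ℝ f p) ↔ ∀ k, holPart (fderiv ℝ (fun x => (f x k : ℂ)) p) v = 0 := by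
  simp [complexKer, holPart_apply, fderiv_ofReal_component hf, funext_iff, Complex.ext_iff,
    forall_and]

theorem mem_complexKer_iff_antiholPart_eq_zero [Fintype κ] (hf : DifferentiableAt ℝ f p) {v : E} :
    v ∈ complexKer (fderiv ℝ f p) ↔
      ∀ k, antiholPart (fderiv ℝ (fun x => (f x k : ℂ)) p) v = 0 := by
  simp [complexKer, antiholPart_apply, fderiv_ofReal_component hf, funext_iff, Complex.ext_iff,
    forall_and]

variable {N : ℕ} {ρ : (Fin N → ℂ) → κ → ℝ} {q : Fin N → ℂ}

theorem dZbar_ofReal_component [Finite κ] (hρ : DifferentiableAt ℝ ρ q) (k : κ) (l : Fin N) :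
    dZbar l (fun Z => (ρ Z k : ℂ)) q = star (dZ l (fun Z => (ρ Z k : ℂ)) q) := by
  simp [dZ, dZbar, fderiv_ofReal_component hρ]

theorem range_fderiv_eq_top_of_linearIndependent_dZ [Finite κ] (hρ : DifferentiableAt ℝ ρ q)
    (hgen : LinearIndependent ℂ fun k j => dZ j (fun Z => (ρ Z k : ℂ)) q) :
    (fderiv ℝ ρ q).range = ⊤ := by
  refine LinearMap.range_eq_top.mpr fun y => ?_
  obtain ⟨v, hv⟩ := mulVec_surjective_of_linearIndependent_row
    (P := Matrix.of fun k j => dZ j (fun Z => (ρ Z k : ℂ)) q) hgen fun k => 1 / 2 * (y k : ℂ)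
  refine ⟨v, funext fun k => ?_⟩
  have hk := congrFun hv k
  rw [mulVec, dotProduct_comm] at hk
  have hre := congrArg Complex.re ((dotProduct_dZ _ q v).symm.trans hk)
  simpa [holPart_apply, fderiv_ofReal_component hρ] using hre

theorem linearIndependent_antiholGrad_taylorSeries [Finite κ] (hρ : DifferentiableAt ℝ ρ q)
    (hgen : LinearIndependent ℂ fun k j => dZ j (fun Z => (ρ Z k : ℂ)) q) :
    LinearIndependent ℂ fun k => antiholGrad (taylorSeries (fun Z => (ρ Z k : ℂ)) q) := by
  simp only [antiholGrad_taylorSeries, dZbar_ofReal_component hρ]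
  exact hgen.map_of_surjective_injectiveₛ star (starAddEquiv (R := Fin N → ℂ)).toAddMonoidHom
    star_involutive.surjective star_injective fun c v => star_smul _ _

theorem isFormallyLeviNondegenerate_taylorSeries [Fintype κ] (hρ : ContDiffAt ℝ 2 ρ q)
    (hlevi : IsLeviNondegenerateAt ρ q) :
    IsFormallyLeviNondegenerate fun k => taylorSeries (fun Z => (ρ Z k : ℂ)) q := by
  have hρq := hρ.differentiableAt two_ne_zero
  intro v hv horth
  simp only [holGrad_taylorSeries, dotProduct_dZ] at hv
  refine hlevi v ((mem_complexKer_iff_holPart_eq_zero hρq).mpr hv) fun w hw => funext fun k => ?_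
  have hk := horth (star w) (fun l => by
    rw [antiholGrad_taylorSeries, star_dotProduct_dZbar]
    exact (mem_complexKer_iff_antiholPart_eq_zero hρq).mp hw l) k
  rw [dotProduct_leviMatrix_mulVec_star (contDiffAt_ofReal_component hρ k),
    leviForm_ofReal_component hρ, leviForm_ofReal_component hρ] at hk
  simpa using congrArg Complex.re hk

end RealDefiningFunctions

section GenericSubmanifolds

variable {N n d : ℕ} {M : Set (Fin N → ℂ)} {p : Fin N → ℂ} {U : Set (Fin N → ℂ)}
  {ρ : (Fin N → ℂ) → Fin d → ℝ} {A : Fin d → Matrix (Fin n) (Fin n) ℂ}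
  {Φ : OpenPartialHomeomorph (Fin N → ℂ) ((Fin n → ℂ) × (Fin d → ℂ))}
  {h : (Fin n → ℂ) × (Fin d → ℝ) → Fin d → ℝ}

theorem IsGenericDefiningFunction.contDiffAt (hρ : IsGenericDefiningFunction M p U ρ) :
    ContDiffAt ℝ 2 ρ p :=
  (hρ.contDiffOn.contDiffAt (hρ.isOpen.mem_nhds hρ.mem)).of_le (by norm_cast)

theorem IsReducedFormAt.contDiffAt_chart (hred : IsReducedFormAt M p A Φ h) :
    ContDiffAt ℂ 2 Φ p :=
  (contDiffOn_of_differentiableOn_complex Φ.open_source 2 hred.holomorphic).contDiffAt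
    (Φ.open_source.mem_nhds hred.mem_source)

theorem IsReducedFormAt.contDiffAt_remainder (hred : IsReducedFormAt M p A Φ h) :
    ContDiffAt ℝ 2 h 0 := by
  obtain ⟨V, hV, hh⟩ := hred.smooth
  exact (hh.contDiffAt hV).of_le (by norm_cast)

theorem IsReducedFormAt.fderiv_bijective (hred : IsReducedFormAt M p A Φ h) :
    Function.Bijective (fderiv ℂ Φ p) := by
  have hmem : Φ p ∈ Φ.target := Φ.map_source hred.mem_source
  have hΦ : HasFDerivAt Φ (fderiv ℂ Φ p) p :=
    (hred.contDiffAt_chart.differentiableAt two_ne_zero).hasFDerivAt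
  have hΦ' : HasFDerivAt Φ (fderiv ℂ Φ p) (Φ.symm (Φ p)) := by rwa [Φ.left_inv hred.mem_source]
  have hsymm : HasFDerivAt Φ.symm (fderiv ℂ Φ.symm (Φ p)) (Φ p) :=
    (hred.holomorphic_symm.differentiableAt (Φ.open_target.mem_nhds hmem)).hasFDerivAt
  have hleft := (hsymm.comp p hΦ).unique
    ((hasFDerivAt_id p).congr_of_eventuallyEq (Φ.eventually_left_inverse hred.mem_source))
  have hright := (hΦ'.comp (Φ p) hsymm).unique
    ((hasFDerivAt_id (Φ p)).congr_of_eventuallyEq (Φ.eventually_right_inverse hmem))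
  exact ⟨Function.LeftInverse.injective (DFunLike.congr_fun hleft),
    Function.RightInverse.surjective (DFunLike.congr_fun hright)⟩

theorem IsReducedFormAt.eventually_reducedDefiningFunction_eq_zero
    (hred : IsReducedFormAt M p A Φ h) :
    ∀ᶠ Z in 𝓝 p, Z ∈ M → reducedDefiningFunction A h (Φ Z) = 0 := by
  filter_upwards [hred.equation] with Z hZ hZM
  ext k
  have hk := congrArg Complex.re (hZ.mp hZM k)
  simpa [reducedDefiningFunction, reducedGraph, reQuad, imPart, rePart, sub_eq_zero] using hk

theorem IsReducedFormAt.isLeviNondegenerateAt (hred : IsReducedFormAt M p A Φ h)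
    (hb : ConditionB A) (hp : p ∈ M) (hρ : IsGenericDefiningFunction M p U ρ) :
    IsLeviNondegenerateAt ρ p := by
  have hh := hred.contDiffAt_remainder
  have hr : ContDiffAt ℝ 2 (reducedDefiningFunction A h) (Φ p) :=
    hred.map_base ▸ contDiffAt_reducedDefiningFunction hh
  have hΦ := hred.contDiffAt_chart
  have hlevi : IsLeviNondegenerateAt (reducedDefiningFunction A h) (Φ p) :=
    hred.map_base ▸ isLeviNondegenerateAt_reducedDefiningFunction hred.hermitian hh
      hred.negligible hb
  have hsurj : (fderiv ℝ (reducedDefiningFunction A h ∘ Φ) p).range = ⊤ := by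
    rw [fderiv_comp p (hr.differentiableAt two_ne_zero)
      ((hΦ.restrict_scalars ℝ).differentiableAt two_ne_zero), hred.map_base,
      fderiv_reducedDefiningFunction hh hred.negligible]
    have hΦsurj : Function.Surjective (fderiv ℝ Φ p) := by
      convert hred.fderiv_bijective.surjective using 1
      exact funext (fderiv_real_apply_eq_fderiv_complex (hΦ.differentiableAt two_ne_zero))
    exact LinearMap.range_eq_top.mpr
      ((LinearMap.range_eq_top.mp range_imPart_comp_snd).comp hΦsurj)
  have hvanish := hred.eventually_reducedDefiningFunction_eq_zero
  have hrΦ := hvanish.self_of_nhds hp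
  refine (hlevi.comp hΦ hr hred.fderiv_bijective).of_constant_on_levelSet hρ.contDiffAt
    (range_fderiv_eq_top_of_linearIndependent_dZ (hρ.contDiffAt.differentiableAt two_ne_zero)
      (hρ.generic p hρ.mem)) (hr.comp p (hΦ.restrict_scalars ℝ)) hsurj ?_
  filter_upwards [hvanish, hρ.isOpen.mem_nhds hρ.mem] with Z hZ hZU hρZ
  rw [(hρ.zeroSet p hρ.mem).mp hp] at hρZ
  exact (hZ ((hρ.zeroSet Z hZU).mpr hρZ)).trans hrΦ.symm

end GenericSubmanifolds

end CRGeometry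

theorem mainTheorem5 {N n d : ℕ} (M : Set (Fin N → ℂ)) (p : Fin N → ℂ) (hp : p ∈ M)
    (hM : CRGeometry.IsSmoothGenericSubmanifold M d)
    (A : Fin d → Matrix (Fin n) (Fin n) ℂ)
    (Φ : OpenPartialHomeomorph (Fin N → ℂ) ((Fin n → ℂ) × (Fin d → ℂ)))
    (h : (Fin n → ℂ) × (Fin d → ℝ) → Fin d → ℝ)
    (hred : CRGeometry.IsReducedFormAt M p A Φ h)
    (hb : CRGeometry.ConditionB A) :
    CRGeometry.IsFormallyHolNondegenerateAt M d p := by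
  rintro ⟨X, hX, U, ρ, hρ, c, hc⟩
  have hρ₂ : ContDiffAt ℝ 2 ρ p := hρ.contDiffAt
  have hρp : ρ p = 0 := (hρ.zeroSet p hρ.mem).mp hp
  have hlevi : CRGeometry.IsLeviNondegenerateAt ρ p := hred.isLeviNondegenerateAt hb hp hρ
  refine hX (CRGeometry.eq_zero_of_isFormallyLeviNondegenerate
    (fun k => by simp [CRGeometry.constantCoeff_taylorSeries, hρp])
    (CRGeometry.linearIndependent_antiholGrad_taylorSeries
      (hρ₂.differentiableAt two_ne_zero) (hρ.generic p hρ.mem))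
    (CRGeometry.isFormallyLeviNondegenerate_taylorSeries hρ₂ hlevi) fun k => ?_)
  rw [← CRGeometry.FormalHolVectorField.act, hc k]
  exact Ideal.sum_mem _ fun l _ => Ideal.mul_mem_left _ _ (Ideal.subset_span ⟨l, rfl⟩)
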